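/- Let $\mathcal C$ be a $\otimes$-factor braided abelian category: an abelian category with a braided monoidal structure $(\otimes,\mathbf 1,\Psi)$ whose tensor product is bi-additive and such that the tensor product of two epimorphisms is an epimorphism and the tensor product of two monomorphisms is a monomorphism. Let $\lambda\in\mathrm{Aut}(\mathbf 1)$, acting on the morphisms of $\mathcal C$ as a scalar, and let $X$ be an object of $\mathcal C$. Let $\mathcal C^{\mathbb N}$ be the category of $\mathbb N_0$-graded objects of $\mathcal C$, with tensor product $(\hat Y\otimes\hat Z)_n=\bigoplus_{k+l=n}Y_k\otimes Z_l$, unit object $(\mathbf 1,0,0,\dots)$ and braiding $(\hat\Psi^{(\lambda)}_{\hat Y,\hat Z})_n=\bigoplus_{k+l=n}\lambda^{kl}\,\Psi_{Y_k,Z_l}$. Let $T(X)$ be the graded object with $T(X)_n=X^{\otimes n}$ (and $X^{\otimes 0}=\mathbf 1$). For $\sigma\in S_j$ with reduced expression $\sigma=t_{a_1}\cdots t_{a_\ell}$ in the neighbour transpositions $t_a=(a\;\,a{+}1)$, permutations being composed as functions, put $\ell(\sigma)=\ell$ and $\sigma_{\mathcal C}(X)=\psi_{a_1}\circ\cdots\circ\psi_{a_\ell}\in\mathrm{End}(X^{\otimes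 j})$, where $\psi_a=\mathrm{id}_{X^{\otimes (a-1)}}\otimes\Psi_{X,X}\otimes\mathrm{id}_{X^{\otimes (j-a-1)}}$. Let $S^{n+m}_{n,m}\subset S_{n+m}$ be the set of the permutations that map $n$ elements to $\{1,\dots,n\}$ and the other $m$ elements to $\{n+1,\dots,n+m\}$, in both cases without changing their order, and put $$\Big[{n+m\atop n}\Big|X;\lambda\Big]=\sum_{\sigma\in S^{n+m}_{n,m}}\lambda^{\ell(\sigma)}\sigma_{\mathcal C}(X),\qquad \Big[{n\atop n+m}\Big|X;\lambda\Big]=\sum_{\sigma^{-1}\in S^{n+m}_{n,m}}\lambda^{\ell(\sigma)}\sigma_{\mathcal C}(X).$$ Then, up to the canonical identifications $X^{\otimes n}\otimes X^{\otimes m}\cong X^{\otimes (n+m)}$: (1) $T(X)$ is a Hopf algebra in $(\mathcal C^{\mathbb N},\hat\Psi^{(\lambda)})$ with product $m_{n,m}=\mathrm{id}:X^{\otimes n}\otimes X^{\otimes m}\to X^{\otimes(n+m)}$, unit $\eta_0=\mathrm{id}_{\mathbf 1}$ and $\eta_j=0$ for $j\neq0$, coproduct $\Delta_{n,m}=\big[{n+m\atop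 n}\big|X;\lambda\big]:X^{\otimes(n+m)}\to X^{\otimes n}\otimes X^{\otimes m}$, counit $\varepsilon_0=\mathrm{id}_{\mathbf 1}$ and $\varepsilon_j=0$ for $j\ne0$, and antipode $S_n=(-1)^n\lambda^{\binom n2}(\sigma^0_n)_{\mathcal C}(X)$, where $\sigma_n^0\in S_n$ is the order-reversing permutation $i\mapsto n+1-i$. (2) $T(X)$ is also a Hopf algebra in $(\mathcal C^{\mathbb N},\hat\Psi^{(\lambda)})$ with product $\big[{n\atop n+m}\big|X;\lambda\big]:X^{\otimes n}\otimes X^{\otimes m}\to X^{\otimes(n+m)}$, coproduct $\mathrm{id}:X^{\otimes(n+m)}\to X^{\otimes n}\otimes X^{\otimes m}$, and the same unit, counit and antipode as in (1). -/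

import Mathlib

open CategoryTheory MonoidalCategory Limits

universe v u

namespace BraidedTensorHopf

section Scalars

variable {C : Type u} [Category.{v} C] [MonoidalCategory C]

/-- The action of an automorphism `s` of the unit object on an object `X`:
`X ≅ 𝟙 ⊗ X → 𝟙 ⊗ X ≅ X` with `s ⊗ id` in the middle. A scalar multiple `s • f` of a morphism
`f : X ⟶ Y` is `(scalar s X).hom ≫ f`. -/
def scalar (s : Aut (𝟙_ C)) (X : C) : X ≅ X :=
  (λ_ X).symm ≪≫ whiskerRightIso s X ≪≫ λ_ X

theorem scalar_hom (s : Aut (𝟙_ C)) (X : C) :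
    (scalar s X).hom = (λ_ X).inv ≫ s.hom ▷ X ≫ (λ_ X).hom := rfl

theorem scalar_naturality (s : Aut (𝟙_ C)) {X Y : C} (f : X ⟶ Y) :
    (scalar s X).hom ≫ f = f ≫ (scalar s Y).hom := by
  simp only [scalar_hom, Category.assoc]
  rw [leftUnitor_inv_naturality_assoc, ← leftUnitor_naturality, whisker_exchange_assoc]

theorem scalar_naturality_assoc (s : Aut (𝟙_ C)) {X Y Z : C} (f : X ⟶ Y) (g : Y ⟶ Z) :
    (scalar s X).hom ≫ f ≫ g = f ≫ (scalar s Y).hom ≫ g := by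
  rw [← Category.assoc, scalar_naturality, Category.assoc]

theorem scalar_mul (s t : Aut (𝟙_ C)) (X : C) :
    (scalar (s * t) X).hom = (scalar t X).hom ≫ (scalar s X).hom := by
  change (λ_ X).inv ≫ (t.hom ≫ s.hom) ▷ X ≫ (λ_ X).hom = _
  simp only [scalar_hom, comp_whiskerRight, Category.assoc, Iso.hom_inv_id_assoc]

theorem scalar_whiskerRight (s : Aut (𝟙_ C)) (X Y : C) :
    (scalar s X).hom ▷ Y = (scalar s (X ⊗ Y)).hom := by
  simp only [scalar_hom, comp_whiskerRight, leftUnitor_whiskerRight, leftUnitor_inv_whiskerRight,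
    whiskerRight_tensor, Category.assoc]

theorem whiskerLeft_scalar [BraidedCategory C] (s : Aut (𝟙_ C)) (X Y : C) :
    X ◁ (scalar s Y).hom = (scalar s (X ⊗ Y)).hom := by
  rw [← cancel_mono (β_ X Y).hom, BraidedCategory.braiding_naturality_right, scalar_whiskerRight,
    ← scalar_naturality]

end Scalars

section Graded

variable {C : Type u} [Category.{v} C] [Abelian C] [MonoidalCategory C]

instance preservesFiniteCoproducts_curriedTensor [MonoidalPreadditive C] (X : C) :
    PreservesFiniteCoproducts ((curriedTensor C).obj X) := inferInstance

variable [BraidedCategory C]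

open GradedObject.Monoidal (ιTensorObj tensorObjDesc ι_tensorObjDesc tensorObj_ext)

/-- The morphism `Y ⊗ Z ⟶ Z ⊗ Y` of graded objects given on the summand `Y i ⊗ Z j` by
`lam ^ (i * j)` times the braiding of `C`. -/
noncomputable def gradedBraidingHom (lam : Aut (𝟙_ C)) (Y Z : GradedObject ℕ C) :
    GradedObject.Monoidal.tensorObj Y Z ⟶ GradedObject.Monoidal.tensorObj Z Y := fun k =>
  tensorObjDesc (fun i j hij => (scalar (lam ^ (i * j)) (Y i ⊗ Z j)).hom ≫ (β_ (Y i) (Z j)).hom ≫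
    ιTensorObj Z Y j i k (by rw [add_comm, hij]))

/-- The inverse of `gradedBraidingHom`. -/
noncomputable def gradedBraidingInv (lam : Aut (𝟙_ C)) (Y Z : GradedObject ℕ C) :
    GradedObject.Monoidal.tensorObj Z Y ⟶ GradedObject.Monoidal.tensorObj Y Z := fun k =>
  tensorObjDesc (fun j i hij => (β_ (Y i) (Z j)).inv ≫ (scalar (lam ^ (i * j)) (Y i ⊗ Z j)).inv ≫
    ιTensorObj Y Z i j k (by rw [add_comm, hij]))

theorem ι_gradedBraidingHom (lam : Aut (𝟙_ C)) (Y Z : GradedObject ℕ C) (i j k : ℕ)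
    (hij : i + j = k) :
    ιTensorObj Y Z i j k hij ≫ gradedBraidingHom lam Y Z k =
      (scalar (lam ^ (i * j)) (Y i ⊗ Z j)).hom ≫ (β_ (Y i) (Z j)).hom ≫
        ιTensorObj Z Y j i k (by rw [add_comm, hij]) :=
  ι_tensorObjDesc _ _ _ _

theorem ι_gradedBraidingHom_assoc (lam : Aut (𝟙_ C)) (Y Z : GradedObject ℕ C) (i j k : ℕ)
    (hij : i + j = k) {A : C} (f : GradedObject.Monoidal.tensorObj Z Y k ⟶ A) :
    ιTensorObj Y Z i j k hij ≫ gradedBraidingHom lam Y Z k ≫ f =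
      (scalar (lam ^ (i * j)) (Y i ⊗ Z j)).hom ≫ (β_ (Y i) (Z j)).hom ≫
        ιTensorObj Z Y j i k (by rw [add_comm, hij]) ≫ f := by
  rw [← Category.assoc, ι_gradedBraidingHom, Category.assoc, Category.assoc]

theorem ι_gradedBraidingInv (lam : Aut (𝟙_ C)) (Y Z : GradedObject ℕ C) (i j k : ℕ)
    (hij : j + i = k) :
    ιTensorObj Z Y j i k hij ≫ gradedBraidingInv lam Y Z k =
      (β_ (Y i) (Z j)).inv ≫ (scalar (lam ^ (i * j)) (Y i ⊗ Z j)).inv ≫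
        ιTensorObj Y Z i j k (by rw [add_comm, hij]) :=
  ι_tensorObjDesc _ _ _ _

/-- The `lam`-braiding of graded objects. -/
noncomputable def gradedBraidingIso (lam : Aut (𝟙_ C)) (Y Z : GradedObject ℕ C) :
    GradedObject.Monoidal.tensorObj Y Z ≅ GradedObject.Monoidal.tensorObj Z Y where
  hom := gradedBraidingHom lam Y Z
  inv := gradedBraidingInv lam Y Z
  hom_inv_id := by
    funext k
    apply tensorObj_ext
    intro i j hij
    rw [GradedObject.categoryOfGradedObjects_comp, ← Category.assoc, ι_gradedBraidingHom,
      Category.assoc, Category.assoc, ι_gradedBraidingInv]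
    simp
  inv_hom_id := by
    funext k
    apply tensorObj_ext
    intro i j hij
    rw [GradedObject.categoryOfGradedObjects_comp, ← Category.assoc, ι_gradedBraidingInv,
      Category.assoc, Category.assoc, ι_gradedBraidingHom]
    simp

theorem gradedBraiding_naturality (lam : Aut (𝟙_ C)) {Y Y' Z Z' : GradedObject ℕ C}
    (f : Y ⟶ Y') (g : Z ⟶ Z') :
    GradedObject.Monoidal.tensorHom f g ≫ gradedBraidingHom lam Y' Z' =
      gradedBraidingHom lam Y Z ≫ GradedObject.Monoidal.tensorHom g f := by
  funext k
  apply tensorObj_ext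
  intro i j hij
  rw [GradedObject.categoryOfGradedObjects_comp, GradedObject.categoryOfGradedObjects_comp,
    GradedObject.Monoidal.ι_tensorHom_assoc, ι_gradedBraidingHom, ι_gradedBraidingHom_assoc,
    GradedObject.Monoidal.ι_tensorHom, ← scalar_naturality_assoc,
    BraidedCategory.braiding_naturality_assoc]

variable [MonoidalPreadditive C]

open GradedObject.Monoidal (ιTensorObj₃'_eq_assoc ιTensorObj₃_eq_assoc ιTensorObj₃'_eq
  ιTensorObj₃_eq ιTensorObj₃'_associator_hom_assoc ιTensorObj₃'_associator_hom
  ιTensorObj₃_associator_inv_assoc ιTensorObj₃_associator_inv ι_tensorHom_assoc ι_tensorHom)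

theorem gradedBraiding_hexagon_forward (lam : Aut (𝟙_ C)) (X Y Z : GradedObject ℕ C) :
    (GradedObject.Monoidal.associator X Y Z).hom ≫
        gradedBraidingHom lam X (GradedObject.Monoidal.tensorObj Y Z) ≫
          (GradedObject.Monoidal.associator Y Z X).hom =
      GradedObject.Monoidal.tensorHom (gradedBraidingHom lam X Y) (𝟙 Z) ≫
        (GradedObject.Monoidal.associator Y X Z).hom ≫
          GradedObject.Monoidal.tensorHom (𝟙 Y) (gradedBraidingHom lam X Z) := by
  funext k
  apply GradedObject.Monoidal.tensorObj₃'_ext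
  intro i₁ i₂ i₃ h
  simp only [GradedObject.categoryOfGradedObjects_comp]
  conv_lhs => rw [ιTensorObj₃'_associator_hom_assoc, ιTensorObj₃_eq_assoc X Y Z i₁ i₂ i₃ k h _ rfl,
    ι_gradedBraidingHom_assoc, ← scalar_naturality_assoc,
    BraidedCategory.braiding_naturality_right_assoc,
    BraidedCategory.braiding_tensor_right_hom, Category.assoc, Category.assoc, Category.assoc,
    Category.assoc,
    ← ιTensorObj₃'_eq_assoc Y Z X i₂ i₃ i₁ k (by rw [add_comm _ i₁, ← add_assoc, h]) _ rfl,
    ιTensorObj₃'_associator_hom, Iso.inv_hom_id_assoc, ← scalar_naturality_assoc, mul_add, pow_add,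
    scalar_mul]
  conv_rhs => rw [ιTensorObj₃'_eq_assoc X Y Z i₁ i₂ i₃ k h _ rfl, ι_tensorHom_assoc,
    ← MonoidalCategory.tensorHom_id, MonoidalCategory.tensorHom_comp_tensorHom_assoc,
    ι_gradedBraidingHom, GradedObject.categoryOfGradedObjects_id, Category.comp_id,
    MonoidalCategory.tensorHom_id, comp_whiskerRight, comp_whiskerRight, Category.assoc,
    Category.assoc,
    ← ιTensorObj₃'_eq_assoc Y X Z i₂ i₁ i₃ k
      (by rw [add_comm i₂ i₁, h]) (i₁ + i₂) (add_comm i₂ i₁),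
    ιTensorObj₃'_associator_hom_assoc,
    ιTensorObj₃_eq_assoc Y X Z i₂ i₁ i₃ k (by rw [add_comm i₂ i₁, h]) _ rfl,
    ι_tensorHom, GradedObject.categoryOfGradedObjects_id, id_tensorHom,
    ← MonoidalCategory.whiskerLeft_comp_assoc, ι_gradedBraidingHom,
    MonoidalCategory.whiskerLeft_comp, MonoidalCategory.whiskerLeft_comp, Category.assoc,
    Category.assoc,
    ← ιTensorObj₃_eq Y Z X i₂ i₃ i₁ k (by rw [add_comm _ i₁, ← add_assoc, h])
      (i₁ + i₃) (add_comm _ _), scalar_whiskerRight, whiskerLeft_scalar,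
    ← scalar_naturality_assoc, ← scalar_naturality_assoc]
  simp only [Category.assoc]
  rw [Iso.hom_inv_id_assoc, ← Category.assoc, ← scalar_naturality, Category.assoc]

theorem gradedBraiding_hexagon_reverse (lam : Aut (𝟙_ C)) (X Y Z : GradedObject ℕ C) :
    (GradedObject.Monoidal.associator X Y Z).inv ≫
        gradedBraidingHom lam (GradedObject.Monoidal.tensorObj X Y) Z ≫
          (GradedObject.Monoidal.associator Z X Y).inv =
      GradedObject.Monoidal.tensorHom (𝟙 X) (gradedBraidingHom lam Y Z) ≫
        (GradedObject.Monoidal.associator X Z Y).inv ≫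
          GradedObject.Monoidal.tensorHom (gradedBraidingHom lam X Z) (𝟙 Y) := by
  funext k
  apply GradedObject.Monoidal.tensorObj₃_ext
  intro i₁ i₂ i₃ h
  simp only [GradedObject.categoryOfGradedObjects_comp]
  conv_lhs => rw [ιTensorObj₃_associator_inv_assoc,
    ιTensorObj₃'_eq_assoc X Y Z i₁ i₂ i₃ k h _ rfl,
    ι_gradedBraidingHom_assoc, ← scalar_naturality_assoc,
    BraidedCategory.braiding_naturality_left_assoc,
    BraidedCategory.braiding_tensor_left_hom, Category.assoc, Category.assoc, Category.assoc,
    Category.assoc,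
    ← ιTensorObj₃_eq_assoc Z X Y i₃ i₁ i₂ k (by rw [add_assoc, add_comm i₃, h]) _ rfl,
    ιTensorObj₃_associator_inv, Iso.hom_inv_id_assoc, ← scalar_naturality_assoc,
    add_mul, pow_add, scalar_mul]
  conv_rhs => rw [ιTensorObj₃_eq_assoc X Y Z i₁ i₂ i₃ k h _ rfl, ι_tensorHom_assoc,
    GradedObject.categoryOfGradedObjects_id, id_tensorHom,
    ← MonoidalCategory.whiskerLeft_comp_assoc, ι_gradedBraidingHom,
    MonoidalCategory.whiskerLeft_comp, MonoidalCategory.whiskerLeft_comp, Category.assoc,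
    Category.assoc,
    ← ιTensorObj₃_eq_assoc X Z Y i₁ i₃ i₂ k
      (by rw [add_assoc, add_comm i₃, ← add_assoc, h]) (i₂ + i₃) (add_comm _ _),
    ιTensorObj₃_associator_inv_assoc,
    ιTensorObj₃'_eq_assoc X Z Y i₁ i₃ i₂ k (by rw [add_assoc, add_comm i₃, ← add_assoc, h]) _ rfl,
    ι_tensorHom, GradedObject.categoryOfGradedObjects_id, tensorHom_id,
    ← MonoidalCategory.comp_whiskerRight_assoc, ι_gradedBraidingHom,
    comp_whiskerRight, comp_whiskerRight, Category.assoc, Category.assoc,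
    ← ιTensorObj₃'_eq Z X Y i₃ i₁ i₂ k (by rw [add_assoc, add_comm i₃, h])
      (i₁ + i₃) (add_comm _ _), scalar_whiskerRight, whiskerLeft_scalar]
  simp only [Category.assoc]
  rw [Iso.inv_hom_id_assoc]
  congr 1
  rw [← scalar_naturality_assoc, ← scalar_naturality_assoc]

/-- The braided monoidal category of `ℕ`-graded objects of `C`: the tensor product is
`(Y ⊗ Z) n = ⨁_{i + j = n} Y i ⊗ Z j`, and the braiding is `lam ^ (i * j)` times the braiding
of `C` on the summand `Y i ⊗ Z j`. -/
noncomputable abbrev gradedBraided (lam : Aut (𝟙_ C)) : BraidedCategory (GradedObject ℕ C) where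
  braiding Y Z := gradedBraidingIso lam Y Z
  braiding_naturality_right Y _ _ g := gradedBraiding_naturality lam (𝟙 Y) g
  braiding_naturality_left f Z := gradedBraiding_naturality lam f (𝟙 Z)
  hexagon_forward X Y Z := gradedBraiding_hexagon_forward lam X Y Z
  hexagon_reverse X Y Z := gradedBraiding_hexagon_reverse lam X Y Z

/-- Hopf algebra structures on a graded object, with respect to the `lam`-braiding. -/
abbrev GradedHopf (lam : Aut (𝟙_ C)) (Y : GradedObject ℕ C) : Type v :=
  @HopfObj (GradedObject ℕ C) _ _ (gradedBraided lam) Y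

/-- The projection of the degree `n + m` part of `Y ⊗ Z` onto its summand `Y n ⊗ Z m`. -/
noncomputable def projTensor (Y Z : GradedObject ℕ C) (n m : ℕ) :
    (Y ⊗ Z : GradedObject ℕ C) (n + m) ⟶ Y n ⊗ Z m :=
  tensorObjDesc (fun i j _ =>
    if h : i = n ∧ j = m then eqToHom (by rw [h.1, h.2]) else 0)

/-- The inclusion of the summand `Y n ⊗ Z m` into the degree `n + m` part of `Y ⊗ Z`. -/
noncomputable def inclTensor (Y Z : GradedObject ℕ C) (n m : ℕ) :
    Y n ⊗ Z m ⟶ (Y ⊗ Z : GradedObject ℕ C) (n + m) :=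
  ιTensorObj Y Z n m (n + m) rfl

/-- The degree zero part of the unit object of graded objects is the unit object of `C`. -/
noncomputable def unitZero : (𝟙_ (GradedObject ℕ C)) 0 ≅ 𝟙_ C :=
  GradedObject.Monoidal.tensorUnit₀

variable (C) in
/-- The tensor product of two epimorphisms is an epimorphism and the tensor product of two
monomorphisms is a monomorphism. -/
structure IsTensorFactor : Prop where
  epi_tensorHom : ∀ {W X Y Z : C} (f : W ⟶ X) (g : Y ⟶ Z), Epi f → Epi g → Epi (f ⊗ₘ g)
  mono_tensorHom : ∀ {W X Y Z : C} (f : W ⟶ X) (g : Y ⟶ Z), Mono f → Mono g → Mono (f ⊗ₘ g)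

end Graded

section Permutations

open Equiv

/-- The transposition of the neighbours `a` and `a + 1` in `{0, …, n - 1}`. -/
def adjSwap (n : ℕ) (a : Fin (n - 1)) : Perm (Fin n) :=
  swap ⟨a, by omega⟩ ⟨a + 1, by omega⟩

/-- The product `t_{a₁} t_{a₂} ⋯ t_{aₗ}` in the symmetric group. -/
def wordPerm {n : ℕ} (w : List (Fin (n - 1))) : Perm (Fin n) :=
  (w.map (adjSwap n)).prod

/-- A word in the neighbour transpositions is reduced if no shorter word has the same product. -/
def IsReducedWord {n : ℕ} (w : List (Fin (n - 1))) : Prop :=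
  ∀ w' : List (Fin (n - 1)), wordPerm w' = wordPerm w → w.length ≤ w'.length

theorem exists_wordPerm_eq {n : ℕ} (σ : Perm (Fin n)) :
    ∃ w : List (Fin (n - 1)), wordPerm w = σ := by
  cases n with
  | zero => exact ⟨[], Subsingleton.elim _ _⟩
  | succ n =>
    have h : σ ∈ Submonoid.closure (Set.range fun i : Fin n => swap i.castSucc i.succ) := by
      rw [Perm.mclosure_swap_castSucc_succ]
      trivial
    induction h using Submonoid.closure_induction with
    | mem x hx =>
      obtain ⟨i, rfl⟩ := hx
      exact ⟨[i], by simp only [wordPerm, List.map_cons, List.map_nil, List.prod_singleton]; rfl⟩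
    | one => exact ⟨[], rfl⟩
    | mul x y _ _ hx hy =>
      obtain ⟨u, rfl⟩ := hx
      obtain ⟨w, rfl⟩ := hy
      exact ⟨u ++ w, by simp [wordPerm]⟩

theorem exists_isReducedWord {n : ℕ} (σ : Perm (Fin n)) :
    ∃ w : List (Fin (n - 1)), wordPerm w = σ ∧ IsReducedWord w := by
  classical
  have h : ∃ l, ∃ w : List (Fin (n - 1)), wordPerm w = σ ∧ w.length = l := by
    obtain ⟨w, hw⟩ := exists_wordPerm_eq σ
    exact ⟨_, w, hw, rfl⟩
  obtain ⟨w, hw, hl⟩ := Nat.find_spec h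
  refine ⟨w, hw, fun w' hw' => ?_⟩
  rw [hl]
  exact Nat.find_min' h ⟨w', hw'.trans hw, rfl⟩

/-- A reduced expression of a permutation. -/
noncomputable def reducedWord {n : ℕ} (σ : Perm (Fin n)) : List (Fin (n - 1)) :=
  (exists_isReducedWord σ).choose

/-- The length of a permutation: the number of factors in a reduced expression. -/
noncomputable def permLength {n : ℕ} (σ : Perm (Fin n)) : ℕ :=
  (reducedWord σ).length

/-- The shuffle permutations `σ` for the partition `(n, m)` of `n + m`: they map `n` elements to
the first block `{0, …, n - 1}` and `m` elements to the second block `{n, …, n + m - 1}`,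
without changing the order of elements mapped to the same block. -/
def shuffles (n m : ℕ) : Finset (Perm (Fin (n + m))) :=
  {σ | ∀ a b, a < b → ((σ a : ℕ) < n ↔ (σ b : ℕ) < n) → σ a < σ b}

/-- The inverses of the shuffle permutations. -/
def inverseShuffles (n m : ℕ) : Finset (Perm (Fin (n + m))) :=
  {σ | σ⁻¹ ∈ shuffles n m}

end Permutations

section TensorAlgebra

variable {C : Type u} [Category.{v} C] [MonoidalCategory C]

/-- The tensor power `X ⊗ ⋯ ⊗ X` with `n` factors, bracketed to the left. -/
def tensorPow (X : C) : ℕ → C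
  | 0 => 𝟙_ C
  | n + 1 => tensorPow X n ⊗ X

/-- The tensor algebra of `X`, as a graded object. -/
abbrev tensorAlgebra (X : C) : GradedObject ℕ C := fun n => tensorPow X n

/-- The canonical isomorphism between `X^n ⊗ X^m` and `X^(n + m)` (rebracketing). -/
def concat (X : C) (n : ℕ) : ∀ m : ℕ, tensorPow X n ⊗ tensorPow X m ≅ tensorPow X (n + m)
  | 0 => ρ_ (tensorPow X n)
  | m + 1 => (α_ (tensorPow X n) (tensorPow X m) X).symm ≪≫ whiskerRightIso (concat X n m) X

variable [BraidedCategory C]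

/-- The braiding of `X` with itself on the last two factors of `X^(n + 2)`. -/
def braidLast (X : C) (n : ℕ) : tensorPow X (n + 2) ⟶ tensorPow X (n + 2) :=
  (α_ (tensorPow X n) X X).hom ≫ tensorPow X n ◁ (β_ X X).hom ≫ (α_ (tensorPow X n) X X).inv

/-- For `a + 1 < n`, the braiding of `X` with itself on the factors `a` and `a + 1` of `X^n`
(the factors being numbered `0, …, n - 1`). -/
def braidGen (X : C) : ∀ n : ℕ, ℕ → (tensorPow X n ⟶ tensorPow X n)
  | 0, _ => 𝟙 _
  | 1, _ => 𝟙 _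
  | n + 2, a => if a = n then braidLast X n else braidGen X (n + 1) a ▷ X

/-- The composition `ψ_{a₁} ∘ ψ_{a₂} ∘ ⋯ ∘ ψ_{aₗ}` (so that `ψ_{aₗ}` is applied first), where
`ψ_a` is the braiding on the neighbouring factors `a` and `a + 1`. -/
def braidWord (X : C) {n : ℕ} : List (Fin (n - 1)) → (tensorPow X n ⟶ tensorPow X n)
  | [] => 𝟙 _
  | a :: w => braidWord X w ≫ braidGen X n a

/-- The endomorphism of `X^n` assigned to a permutation `σ = t_{a₁} ⋯ t_{aₗ}` (reduced
expression): the composition `ψ_{a₁} ∘ ⋯ ∘ ψ_{aₗ}` of elementary braidings. -/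
noncomputable def braidLift (X : C) {n : ℕ} (σ : Equiv.Perm (Fin n)) :
    tensorPow X n ⟶ tensorPow X n :=
  braidWord X (reducedWord σ)

variable [Preadditive C]

/-- The braided binomial `[n + m over n | X; lam]`: the sum over the shuffle permutations `σ` for
the partition `(n, m)` of `lam ^ ℓ(σ)` times the braid lift of `σ`. -/
noncomputable def braidedBinomial (lam : Aut (𝟙_ C)) (X : C) (n m : ℕ) :
    tensorPow X (n + m) ⟶ tensorPow X (n + m) :=
  ∑ σ ∈ shuffles n m, (scalar (lam ^ permLength σ) _).hom ≫ braidLift X σ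

/-- The dual braided binomial `[n over n + m | X; lam]`: the sum over the inverses `σ` of the
shuffle permutations for `(n, m)` of `lam ^ ℓ(σ)` times the braid lift of `σ`. -/
noncomputable def dualBraidedBinomial (lam : Aut (𝟙_ C)) (X : C) (n m : ℕ) :
    tensorPow X (n + m) ⟶ tensorPow X (n + m) :=
  ∑ σ ∈ inverseShuffles n m, (scalar (lam ^ permLength σ) _).hom ≫ braidLift X σ

/-- `(-1)^n lam ^ (n choose 2)` times the braid lift of the permutation reversing the order of
the `n` factors. -/
noncomputable def tensorAntipode (lam : Aut (𝟙_ C)) (X : C) (n : ℕ) :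
    tensorPow X n ⟶ tensorPow X n :=
  (-1 : ℤ) ^ n • ((scalar (lam ^ n.choose 2) _).hom ≫ braidLift X (Fin.revPerm : Equiv.Perm (Fin n)))

end TensorAlgebra

end BraidedTensorHopf

open BraidedTensorHopf

/-!
The theorem reduces to identities between sums of braids. Composition with the canonical
isomorphisms `X^i ⊗ X^j ≅ X^(i + j)` turns every structure morphism of `T(X)` into an endomorphism
of a single tensor power `X^N`, and the braidings of neighbouring factors of `X^N`, scaled by `lam`,
are a sequence `s` in the ring `End (X^N)` that satisfies the braid relations (`IsBraidSeq`,
`isBraidSeq_twistedSeq`). The axioms of a Hopf algebra become identities that hold for every such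
sequence in every ring.

The sum over the shuffle permutations is the element `shuf`, defined by a recursion on the block to
which the last strand belongs. Coassociativity (`IsBraidSeq.shuf_coassoc`), the compatibility of
product and coproduct (`IsBraidSeq.shuf_compat`) and one of the antipode identities
(`IsBraidSeq.sum_halfTwist_mul_shuf`) follow by induction along this recursion. The compatibility
also yields the recursion for the first strand, which gives the other antipode identity, an
alternating sum whose terms cancel in pairs. The second Hopf algebra is the first one in the
opposite ring: reversing words preserves the braid relations, takes `shuf` to `dualShuf`, fixes
the half twists and takes the exchange of two blocks of strands to the reverse exchange.

That these recursive elements are the sums of the statement needs that all reduced expressions of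
a permutation have the same value in a monoid in which the braid relations hold
(`IsReducedWord.prod_map_eq`). This is proved by a normal form `permLift`, which moves the last
strand first: `permLift` is multiplicative along ascents (`IsBraidSeq.permLift_adjSwap_mul`), and
applied to the constant sequence in the free monoid on one generator it counts the length of a
reduced expression.

The `lam`-braiding of graded objects enters through the exchange of the two middle factors of
`X^i ⊗ X^j ⊗ X^k ⊗ X^l`, which is an exchange of blocks of strands (`tensorμ_comp_concatTo`).
Finally `GradedHopfComponents` describes a Hopf algebra in the category of graded objects by
morphisms between the homogeneous parts, and `TensorHopfData` collects the identities in
`End (X^N)` that make such components.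
-/

namespace BraidedTensorHopf

/-! ### Sequences satisfying the braid relations -/

section BraidSequences

variable {M : Type*} [Monoid M]

/-- A sequence of elements of a monoid satisfying the braid relations. -/
structure IsBraidSeq (s : ℕ → M) : Prop where
  comm : ∀ a b, a + 2 ≤ b → Commute (s a) (s b)
  braid : ∀ a, s a * s (a + 1) * s a = s (a + 1) * s a * s (a + 1)

theorem IsBraidSeq.op {s : ℕ → M} (hs : IsBraidSeq s) :
    IsBraidSeq fun a => MulOpposite.op (s a) where
  comm a b h := (hs.comm a b h).op
  braid a := MulOpposite.unop_injective (by simpa [mul_assoc] using hs.braid a)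

/-- The product `s a * s (a + 1) * ⋯ * s (a + m - 1)`. In a braid group it moves the strand
`a + m` to the position `a`, in front of the `m` strands `a, …, a + m - 1`. -/
def ascProd (s : ℕ → M) (a : ℕ) : ℕ → M
  | 0 => 1
  | m + 1 => ascProd s a m * s (a + m)

/-- The product `s (a + m - 1) * ⋯ * s (a + 1) * s a`. -/
def descProd (s : ℕ → M) (a : ℕ) : ℕ → M
  | 0 => 1
  | m + 1 => s (a + m) * descProd s a m

/-- The braid that exchanges the block of `j` strands starting at `a` and the following block of
`k` strands. -/
def blockBraid (s : ℕ → M) (a j : ℕ) : ℕ → M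
  | 0 => 1
  | k + 1 => ascProd s (a + k) j * blockBraid s a j k

/-- The half twist of the `m` strands starting at `a`. -/
def halfTwist (s : ℕ → M) (a : ℕ) : ℕ → M
  | 0 => 1
  | m + 1 => ascProd s a m * halfTwist s a m

variable {s s' : ℕ → M} {a a' : ℕ} {x : M}

theorem ascProd_succ' (s : ℕ → M) (a m : ℕ) :
    ascProd s a (m + 1) = s a * ascProd s (a + 1) m := by
  induction m with
  | zero => simp [ascProd]
  | succ m ih => rw [ascProd, ih, ascProd, mul_assoc, show a + 1 + m = a + (m + 1) by omega]

theorem ascProd_add (s : ℕ → M) (a m k : ℕ) :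
    ascProd s a (m + k) = ascProd s a m * ascProd s (a + m) k := by
  induction k with
  | zero => simp [ascProd]
  | succ k ih => rw [← add_assoc, ascProd, ih, ascProd, mul_assoc, add_assoc]

/-- Conjugation with a fixed element turns a product of generators into the product of the
conjugated generators. With `x = 1` this says that the product depends on the generators in its
range only; with `s' = s` and `a' = a` it is a commutation rule. -/
theorem semiconjBy_ascProd {m : ℕ} (h : ∀ b < m, SemiconjBy x (s (a + b)) (s' (a' + b))) :
    SemiconjBy x (ascProd s a m) (ascProd s' a' m) := by
  induction m with
  | zero => exact SemiconjBy.one_right x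
  | succ m ih => exact (ih fun b hb => h b (hb.trans m.lt_succ_self)).mul_right (h m m.lt_succ_self)

theorem semiconjBy_blockBraid {j k : ℕ}
    (h : ∀ b, b + 1 < j + k → SemiconjBy x (s (a + b)) (s' (a' + b))) :
    SemiconjBy x (blockBraid s a j k) (blockBraid s' a' j k) := by
  induction k with
  | zero => exact SemiconjBy.one_right x
  | succ k ih =>
    refine (semiconjBy_ascProd fun b hb => ?_).mul_right (ih fun b hb => h b (by omega))
    rw [add_assoc, add_assoc]
    exact h _ (by omega)

theorem semiconjBy_halfTwist {m : ℕ}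
    (h : ∀ b, b + 1 < m → SemiconjBy x (s (a + b)) (s' (a' + b))) :
    SemiconjBy x (halfTwist s a m) (halfTwist s' a' m) := by
  induction m with
  | zero => exact SemiconjBy.one_right x
  | succ m ih =>
    exact (semiconjBy_ascProd fun b hb => h b (by omega)).mul_right (ih fun b hb => h b (by omega))

/-- A half twist depends on the generators in its range only. -/
theorem halfTwist_congr {m : ℕ} (h : ∀ b, b + 1 < m → s (a + b) = s' (a' + b)) :
    halfTwist s a m = halfTwist s' a' m := by
  simpa [SemiconjBy] using semiconjBy_halfTwist (x := 1) (s := s) (a := a) (s' := s') (a' := a')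
    (m := m) fun b hb => by simp [SemiconjBy, h b hb]

theorem blockBraid_congr {j k : ℕ} (h : ∀ b, b + 1 < j + k → s (a + b) = s' (a' + b)) :
    blockBraid s a j k = blockBraid s' a' j k := by
  simpa [SemiconjBy] using semiconjBy_blockBraid (x := 1) (s := s) (a := a) (s' := s') (a' := a')
    (j := j) (k := k) fun b hb => by simp [SemiconjBy, h b hb]

theorem ascProd_congr {m : ℕ} (h : ∀ b < m, s (a + b) = s' (a' + b)) :
    ascProd s a m = ascProd s' a' m := by
  simpa [SemiconjBy] using semiconjBy_ascProd (x := 1) (s := s) (a := a) (s' := s') (a' := a')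
    (m := m) fun b hb => by simp [SemiconjBy, h b hb]

theorem unop_ascProd (s : ℕ → M) (a m : ℕ) :
    (ascProd (fun b => MulOpposite.op (s b)) a m).unop = descProd s a m := by
  induction m with
  | zero => rfl
  | succ m ih => rw [ascProd, MulOpposite.unop_mul, ih]; rfl

theorem map_ascProd {M' F : Type*} [Monoid M'] [FunLike F M M'] [MonoidHomClass F M M'] (f : F)
    (s : ℕ → M) (a m : ℕ) : f (ascProd s a m) = ascProd (fun b => f (s b)) a m := by
  induction m with
  | zero => exact map_one f
  | succ m ih => rw [ascProd, map_mul, ih]; rfl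

theorem map_blockBraid {M' F : Type*} [Monoid M'] [FunLike F M M'] [MonoidHomClass F M M'] (f : F)
    (s : ℕ → M) (a j k : ℕ) : f (blockBraid s a j k) = blockBraid (fun b => f (s b)) a j k := by
  induction k with
  | zero => exact map_one f
  | succ k ih => rw [blockBraid, map_mul, ih, map_ascProd]; rfl

theorem map_halfTwist {M' F : Type*} [Monoid M'] [FunLike F M M'] [MonoidHomClass F M M'] (f : F)
    (s : ℕ → M) (a m : ℕ) : f (halfTwist s a m) = halfTwist (fun b => f (s b)) a m := by
  induction m with
  | zero => exact map_one f
  | succ m ih => rw [halfTwist, map_mul, ih, map_ascProd]; rfl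

theorem ascProd_central_mul {c : M} (hc : ∀ y, Commute c y) (s : ℕ → M) (a m : ℕ) :
    ascProd (fun b => c * s b) a m = c ^ m * ascProd s a m := by
  induction m with
  | zero => simp [ascProd]
  | succ m ih =>
    rw [ascProd, ih, ascProd, mul_assoc, ← mul_assoc _ c, ← (hc _).eq, pow_succ]
    simp only [mul_assoc]

theorem blockBraid_central_mul {c : M} (hc : ∀ y, Commute c y) (s : ℕ → M) (a j k : ℕ) :
    blockBraid (fun b => c * s b) a j k = c ^ (j * k) * blockBraid s a j k := by
  induction k with
  | zero => simp [blockBraid]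
  | succ k ih =>
    rw [blockBraid, ih, blockBraid, ascProd_central_mul hc, mul_assoc, ← mul_assoc _ (c ^ _),
      ← ((hc _).pow_left _).eq, mul_add, mul_one, add_comm (j * k), pow_add]
    simp only [mul_assoc]

theorem halfTwist_central_mul {c : M} (hc : ∀ y, Commute c y) (s : ℕ → M) (a m : ℕ) :
    halfTwist (fun b => c * s b) a m = c ^ m.choose 2 * halfTwist s a m := by
  induction m with
  | zero => simp [halfTwist]
  | succ m ih =>
    rw [halfTwist, ih, halfTwist, ascProd_central_mul hc, mul_assoc, ← mul_assoc _ (c ^ _),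
      ← ((hc _).pow_left _).eq, Nat.choose_succ_succ' m 1, Nat.choose_one_right, pow_add]
    simp only [mul_assoc]

theorem prod_map_central_mul {c : M} (hc : ∀ y, Commute c y) {ι : Type*} (s : ι → M)
    (w : List ι) : (w.map fun b => c * s b).prod = c ^ w.length * (w.map s).prod := by
  induction w with
  | nil => simp
  | cons b w ih =>
    rw [List.map_cons, List.prod_cons, ih, List.map_cons, List.prod_cons, mul_assoc,
      ← mul_assoc _ (c ^ _), ← ((hc _).pow_left _).eq, List.length_cons, pow_succ']
    simp only [mul_assoc]

theorem IsBraidSeq.central_mul {c : M} (hc : ∀ y, Commute c y) (hs : IsBraidSeq s) :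
    IsBraidSeq fun a => c * s a where
  comm a b h := by
    have h1 : Commute (s a) (c * s b) := (hc _).symm.mul_right (hs.comm a b h)
    exact (hc _).mul_left h1
  braid a := by
    have h : ∀ x y z : M, c * x * (c * y) * (c * z) = c ^ 3 * (x * y * z) := by
      intro x y z
      have := prod_map_central_mul hc id [x, y, z]
      simpa [mul_assoc] using this
    rw [h, h, hs.braid]

namespace IsBraidSeq

/-- Moving a strand to the left past `m + 1` strands shifts a crossing of two of these strands
by one position to the right. -/
theorem semiconjBy_ascProd_shift (hs : IsBraidSeq s) {a b m : ℕ} (hab : a ≤ b)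
    (hb : b + 1 < a + m) : SemiconjBy (ascProd s a m) (s b) (s (b + 1)) := by
  obtain ⟨i, rfl⟩ := Nat.exists_eq_add_of_le hab
  obtain ⟨k, rfl⟩ := Nat.exists_eq_add_of_le (show i + 2 ≤ m by omega)
  rw [ascProd_add, ascProd_add]
  have h1 : Commute (ascProd s (a + (i + 2)) k) (s (a + i)) := by
    refine (semiconjBy_ascProd (s' := s) fun c _ => ?_ : Commute _ _).symm
    exact hs.comm _ _ (by omega)
  have h2 : SemiconjBy (ascProd s (a + i) 2) (s (a + i)) (s (a + i + 1)) := by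
    simpa [SemiconjBy, ascProd, mul_assoc] using hs.braid (a + i)
  have h3 : Commute (ascProd s a i) (s (a + i + 1)) := by
    refine (semiconjBy_ascProd (s' := s) fun c _ => ?_ : Commute _ _).symm
    exact (hs.comm _ _ (by omega)).symm
  exact (SemiconjBy.mul_left h3 h2).mul_left h1

/-- Exchanging a block of `k + 1` strands with a block of `j` strands: the last strand of the
first block moves first. -/
theorem blockBraid_succ_left (hs : IsBraidSeq s) (a k j : ℕ) :
    blockBraid s a (k + 1) j = blockBraid s a k j * descProd s (a + k) j := by
  induction j with
  | zero => simp [blockBraid, descProd]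
  | succ j ih =>
    have h : Commute (s (a + j + k)) (blockBraid s a k j) :=
      semiconjBy_blockBraid fun b hb => (hs.comm _ _ (by omega)).symm
    rw [blockBraid, ih, ascProd, blockBraid, descProd, mul_assoc, ← mul_assoc (s _), h.eq,
      add_right_comm a j k]
    simp only [mul_assoc]

/-- Reversing words turns the exchange of blocks of `j` and `k` strands into the exchange of blocks
of `k` and `j` strands. -/
theorem unop_blockBraid (hs : IsBraidSeq s) (a j k : ℕ) :
    (blockBraid (fun b => MulOpposite.op (s b)) a j k).unop = blockBraid s a k j := by
  induction k with
  | zero =>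
    induction j with
    | zero => rfl
    | succ j ih => simpa [blockBraid, ascProd] using ih
  | succ k ih => rw [blockBraid, MulOpposite.unop_mul, ih, unop_ascProd, hs.blockBraid_succ_left]

/-- The recursion for the half twist that moves the first strand to the end. -/
theorem halfTwist_succ' (hs : IsBraidSeq s) (a m : ℕ) :
    halfTwist s a (m + 1) = halfTwist s a m * descProd s a m := by
  induction m with
  | zero => rfl
  | succ m ih =>
    have h : Commute (s (a + m)) (halfTwist s a m) :=
      semiconjBy_halfTwist fun b hb => (hs.comm _ _ (by omega)).symm
    calc halfTwist s a (m + 1 + 1)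
        = ascProd s a m * s (a + m) * (halfTwist s a m * descProd s a m) := by rw [← ih]; rfl
      _ = ascProd s a m * halfTwist s a m * (s (a + m) * descProd s a m) := by
        rw [mul_assoc, ← mul_assoc (s _), h.eq]
        simp only [mul_assoc]

/-- The half twist is invariant under reversing words. -/
theorem unop_halfTwist (hs : IsBraidSeq s) (a m : ℕ) :
    (halfTwist (fun b => MulOpposite.op (s b)) a m).unop = halfTwist s a m := by
  induction m with
  | zero => rfl
  | succ m ih => rw [halfTwist, MulOpposite.unop_mul, ih, unop_ascProd, hs.halfTwist_succ']

end IsBraidSeq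

end BraidSequences

/-! ### Shuffle elements and their identities -/

section ShuffleElements

open Finset

variable {R : Type*} [Ring R]

/-- The shuffle element on the `n + m` strands starting at `a`: the sum of the positive braids
that move some `n` strands to the front and the other `m` strands to the back, without crossings
among the `n` strands or among the `m` strands. The recursion distinguishes whether the last
strand stays or moves to the last position of the front block. -/
def shuf (s : ℕ → R) (a : ℕ) : ℕ → ℕ → R
  | 0, _ => 1
  | _ + 1, 0 => 1
  | n + 1, m + 1 => shuf s a (n + 1) m + ascProd s (a + n) (m + 1) * shuf s a n (m + 1)

variable {s s' : ℕ → R} {a a' : ℕ} {x : R}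

@[simp] theorem shuf_zero_left (s : ℕ → R) (a m : ℕ) : shuf s a 0 m = 1 := by rw [shuf]

@[simp] theorem shuf_zero_right (s : ℕ → R) (a n : ℕ) : shuf s a n 0 = 1 := by
  cases n <;> rw [shuf]

theorem shuf_succ_succ (s : ℕ → R) (a n m : ℕ) : shuf s a (n + 1) (m + 1) =
    shuf s a (n + 1) m + ascProd s (a + n) (m + 1) * shuf s a n (m + 1) := by rw [shuf]

theorem semiconjBy_shuf {n m : ℕ}
    (h : ∀ b, b + 1 < n + m → SemiconjBy x (s (a + b)) (s' (a' + b))) :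
    SemiconjBy x (shuf s a n m) (shuf s' a' n m) := by
  induction n generalizing m with
  | zero => simp
  | succ n ihn =>
    induction m with
    | zero => simp
    | succ m ihm =>
      rw [shuf_succ_succ, shuf_succ_succ]
      refine (ihm fun b hb => h b (by omega)).add_right
        ((semiconjBy_ascProd fun b hb => ?_).mul_right (ihn fun b hb => h b (by omega)))
      rw [add_assoc, add_assoc]
      exact h _ (by omega)

theorem map_shuf {R' : Type*} [Ring R'] (f : R →+* R') (s : ℕ → R) (a n m : ℕ) :
    f (shuf s a n m) = shuf (fun b => f (s b)) a n m := by
  induction n generalizing m with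
  | zero => simp
  | succ n ihn =>
    induction m with
    | zero => simp
    | succ m ihm => rw [shuf_succ_succ, shuf_succ_succ, map_add, map_mul, ihm, ihn, map_ascProd]

/-- Splitting off the last strand from a sum over the ways to divide `m + 1` strands into two
blocks. -/
theorem sum_antidiagonal_succ_split {A : Type*} [AddCommMonoid A] {F G H : ℕ → ℕ → A}
    (h : ∀ k l, F (k + 1) (l + 1) = G (k + 1) l + H k (l + 1))
    (h₀ : ∀ l, F 0 (l + 1) = G 0 l) (h₁ : ∀ k, F (k + 1) 0 = H k 0) (m : ℕ) :
    ∑ y ∈ antidiagonal (m + 1), F y.1 y.2 =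
      ∑ y ∈ antidiagonal m, G y.1 y.2 + ∑ y ∈ antidiagonal m, H y.1 y.2 := by
  let G' : ℕ → ℕ → A := fun k l => l.casesOn 0 fun l => G k l
  let H' : ℕ → ℕ → A := fun k l => k.casesOn 0 fun k => H k l
  have hF : ∀ y ∈ antidiagonal (m + 1), F y.1 y.2 = G' y.1 y.2 + H' y.1 y.2 := by
    rintro ⟨k, l⟩ hy
    rw [HasAntidiagonal.mem_antidiagonal] at hy
    rcases k with - | k <;> rcases l with - | l
    · simp at hy
    · simp [G', H', h₀]
    · simp [G', H', h₁]
    · exact h k l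
  rw [sum_congr rfl hF, sum_add_distrib, Nat.sum_antidiagonal_succ',
    Nat.sum_antidiagonal_succ (f := fun y => H' y.1 y.2)]
  simp [G', H']

namespace IsBraidSeq

theorem commute_shuf (hs : IsBraidSeq s) {n m c : ℕ} (h : a + n + m ≤ c) :
    Commute (s c) (shuf s a n m) :=
  semiconjBy_shuf (s' := s) fun _ _ => (hs.comm _ _ (by omega)).symm

/-- Dividing the strands into three blocks in two steps, in either order. -/
theorem shuf_coassoc (hs : IsBraidSeq s) (a n m l : ℕ) :
    shuf s a n m * shuf s a (n + m) l = shuf s (a + n) m l * shuf s a n (m + l) := by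
  induction n generalizing m l with
  | zero => simp
  | succ n ihn =>
    induction m generalizing l with
    | zero => simp
    | succ m ihm =>
      induction l with
      | zero => simp
      | succ l ihl =>
        have c1 : Commute (shuf s a (n + 1) m) (ascProd s (a + (n + 1 + m)) (l + 1)) :=
          semiconjBy_ascProd fun b hb => (hs.commute_shuf (by omega)).symm
        have c2 : SemiconjBy (ascProd s (a + n) (m + 1 + (l + 1))) (shuf s (a + n) (m + 1) (l + 1))
            (shuf s (a + (n + 1)) (m + 1) (l + 1)) := by
          refine semiconjBy_shuf fun b hb => ?_
          rw [show a + (n + 1) + b = a + n + b + 1 by omega]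
          exact hs.semiconjBy_ascProd_shift (by omega) (by omega)
        have c3 : Commute (shuf s a n (m + 1)) (ascProd s (a + (n + 1 + m)) (l + 1)) :=
          semiconjBy_ascProd fun b hb => (hs.commute_shuf (by omega)).symm
        have h1 := ihm (l + 1)
        have h2 := ihn (m + 1) (l + 1)
        rw [show n + (m + 1) = n + 1 + m by omega] at h2
        rw [show m + (l + 1) = m + 1 + l by omega] at h1
        have e1 : shuf s a (n + 1 + (m + 1)) (l + 1) = shuf s a (n + 1 + (m + 1)) l +
            ascProd s (a + (n + 1 + m)) (l + 1) * shuf s a (n + 1 + m) (l + 1) :=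
          shuf_succ_succ s a (n + 1 + m) l
        have e2 : shuf s a (n + 1) (m + 1 + (l + 1)) = shuf s a (n + 1) (m + 1 + l) +
            ascProd s (a + n) (m + 1 + (l + 1)) * shuf s a n (m + 1 + (l + 1)) :=
          shuf_succ_succ s a n (m + 1 + l)
        have e3 : shuf s (a + (n + 1)) (m + 1) (l + 1) = shuf s (a + (n + 1)) (m + 1) l +
            ascProd s (a + (n + 1 + m)) (l + 1) * shuf s (a + (n + 1)) m (l + 1) := by
          rw [shuf_succ_succ, add_assoc a (n + 1) m]
        have e4 := shuf_succ_succ s a n m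
        have e5 : ascProd s (a + n) (m + 1 + (l + 1)) =
            ascProd s (a + n) (m + 1) * ascProd s (a + (n + 1 + m)) (l + 1) := by
          rw [ascProd_add, show a + n + (m + 1) = a + (n + 1 + m) by omega]
        -- the last strand goes to the third, the second or the first block
        calc shuf s a (n + 1) (m + 1) * shuf s a (n + 1 + (m + 1)) (l + 1)
            = shuf s a (n + 1) (m + 1) * shuf s a (n + 1 + (m + 1)) l +
              ascProd s (a + (n + 1 + m)) (l + 1) *
                (shuf s a (n + 1) m * shuf s a (n + 1 + m) (l + 1)) +
              ascProd s (a + n) (m + 1 + (l + 1)) *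
                (shuf s a n (m + 1) * shuf s a (n + 1 + m) (l + 1)) := by
              rw [e1, mul_add, add_assoc (_ * _)]
              congr 1
              rw [e4, add_mul, e5, ← mul_assoc (shuf s a (n + 1) m), c1.eq,
                mul_assoc (ascProd s (a + n) (m + 1)) (shuf _ _ _ _),
                ← mul_assoc (shuf s a n (m + 1)), c3.eq]
              simp only [mul_assoc]
          _ = _ := by
              rw [ihl, h1, h2, ← mul_assoc _ (shuf s (a + n) _ _), c2.eq, e2, mul_add, e3]
              simp only [mul_assoc, add_mul]

/-- The compatibility of the product and the coproduct: dividing `n + m` strands into blocks of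
sizes `p` and `q` means to divide the first `n` and the last `m` strands separately, and then to
exchange the two middle blocks. -/
theorem shuf_compat (hs : IsBraidSeq s) (n m p q : ℕ) (h : p + q = n + m) :
    shuf s 0 p q = ∑ x ∈ antidiagonal n, ∑ y ∈ antidiagonal m, if x.1 + y.1 = p then
      blockBraid s x.1 x.2 y.1 * shuf s 0 x.1 x.2 * shuf s n y.1 y.2 else 0 := by
  induction m generalizing p q with
  | zero =>
    rw [sum_eq_single_of_mem (p, q) (by simpa using h)]
    · simp [blockBraid]
    · rintro ⟨i, j⟩ hx hne
      have : i ≠ p := by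
        rintro rfl
        rw [HasAntidiagonal.mem_antidiagonal] at hx
        exact hne (Prod.ext rfl (by dsimp only at *; omega))
      simp [this]
  | succ m ih =>
    have key : ∀ x ∈ antidiagonal n, (∑ y ∈ antidiagonal (m + 1), if x.1 + y.1 = p then
        blockBraid s x.1 x.2 y.1 * shuf s 0 x.1 x.2 * shuf s n y.1 y.2 else 0) =
        (∑ y ∈ antidiagonal m, if x.1 + y.1 = p then
          blockBraid s x.1 x.2 y.1 * shuf s 0 x.1 x.2 * shuf s n y.1 y.2 else 0) +
        ∑ y ∈ antidiagonal m, if x.1 + y.1 + 1 = p then ascProd s (x.1 + y.1) (x.2 + y.2) *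
          (blockBraid s x.1 x.2 y.1 * shuf s 0 x.1 x.2 * shuf s n y.1 y.2) else 0 := by
      rintro ⟨i, j⟩ hx
      rw [HasAntidiagonal.mem_antidiagonal] at hx
      dsimp only at hx ⊢
      have hc : ∀ k l, blockBraid s i j (k + 1) * shuf s 0 i j *
          (ascProd s (n + k) l * shuf s n k l) = ascProd s (i + k) (j + l) *
            (blockBraid s i j k * shuf s 0 i j * shuf s n k l) := by
        intro k l
        have c1 : Commute (blockBraid s i j k * shuf s 0 i j) (ascProd s (n + k) l) := by
          refine semiconjBy_ascProd fun b hb => Commute.symm ?_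
          refine Commute.mul_right ?_ ?_
          · exact semiconjBy_blockBraid (s' := s) fun c hc => (hs.comm _ _ (by omega)).symm
          · exact hs.commute_shuf (by omega)
        rw [blockBraid, ascProd_add, ← mul_assoc _ _ (shuf s n k l),
          show i + k + j = n + k by omega]
        rw [mul_assoc (ascProd s (i + k) j), mul_assoc (ascProd s (i + k) j), c1.eq]
        simp only [mul_assoc]
      refine sum_antidiagonal_succ_split
        (F := fun k l => if i + k = p then
          blockBraid s i j k * shuf s 0 i j * shuf s n k l else 0)
        (G := fun k l => if i + k = p then
          blockBraid s i j k * shuf s 0 i j * shuf s n k l else 0)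
        (H := fun k l => if i + k + 1 = p then ascProd s (i + k) (j + l) *
          (blockBraid s i j k * shuf s 0 i j * shuf s n k l) else 0) ?_ ?_ ?_ m
      · intro k l
        rw [← add_assoc]
        split_ifs
        · rw [shuf_succ_succ, mul_add, hc]
        · simp
      · simp
      · intro k
        have := hc k 0
        simp only [ascProd, shuf_zero_right, mul_one] at this
        simp [this, ← add_assoc]
    rw [sum_congr rfl key, sum_add_distrib]
    have second : ∀ p' q', p' + q' = n + m → p = p' + 1 →
        (∑ x ∈ antidiagonal n, ∑ y ∈ antidiagonal m, if x.1 + y.1 + 1 = p then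
          ascProd s (x.1 + y.1) (x.2 + y.2) *
          (blockBraid s x.1 x.2 y.1 * shuf s 0 x.1 x.2 * shuf s n y.1 y.2) else 0) =
        ascProd s p' q' * shuf s 0 p' q' := by
      rintro p' q' hp rfl
      rw [ih p' q' hp, mul_sum]
      refine sum_congr rfl fun x hx => ?_
      rw [mul_sum]
      refine sum_congr rfl fun y hy => ?_
      rw [HasAntidiagonal.mem_antidiagonal] at hx hy
      simp only [Nat.add_right_cancel_iff]
      split_ifs with hxy
      · rw [hxy, show x.2 + y.2 = q' by omega]
      · simp
    rcases p with - | p <;> rcases q with - | q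
    · omega
    · rw [← ih 0 q (by omega)]
      simp
    · rw [second p 0 (by omega) rfl, sum_eq_zero]
      · simp [ascProd]
      · intro x hx
        refine sum_eq_zero fun y hy => if_neg ?_
        rw [HasAntidiagonal.mem_antidiagonal] at hx hy
        omega
    · rw [second p (q + 1) (by omega) rfl, ← ih (p + 1) q (by omega), shuf_succ_succ, zero_add]

/-- The recursion for the shuffle element that looks at the first strand: it stays, or it moves to
the first position of the back block. -/
theorem shuf_succ_succ' (hs : IsBraidSeq s) (n m : ℕ) : shuf s 0 (n + 1) (m + 1) =
    shuf s 1 n (m + 1) + descProd s 0 (n + 1) * shuf s 1 (n + 1) m := by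
  have hb : ∀ k, blockBraid s 0 1 k = descProd s 0 k := by
    intro k
    induction k with
    | zero => rfl
    | succ k ih => simp [blockBraid, ih, ascProd, descProd]
  have hb' : ∀ k, blockBraid s 1 0 k = 1 := by
    intro k
    induction k with
    | zero => rfl
    | succ k ih => simp [blockBraid, ih, ascProd]
  rw [hs.shuf_compat 1 (n + 1 + m) (n + 1) (m + 1) (by omega)]
  simp only [Nat.sum_antidiagonal_succ, Nat.antidiagonal_zero, sum_singleton]
  rw [add_comm]
  congr 1
  · rw [sum_eq_single_of_mem (n, m + 1) (by simp [add_right_comm, add_assoc])]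
    · simp [add_comm 1 n, hb']
    · rintro ⟨k, l⟩ hy hne
      rw [HasAntidiagonal.mem_antidiagonal] at hy
      refine if_neg fun hk => hne (Prod.ext ?_ ?_) <;> dsimp only at * <;> omega
  · rw [sum_eq_single_of_mem (n + 1, m) (by simp)]
    · simp [hb]
    · rintro ⟨k, l⟩ hy hne
      rw [HasAntidiagonal.mem_antidiagonal] at hy
      refine if_neg fun hk => hne (Prod.ext ?_ ?_) <;> dsimp only at * <;> omega

/-- The right antipode identity: the terms in which the last strand of the front block moved
past the back block cancel those in which it is the first strand of the back block. -/
theorem sum_halfTwist_mul_shuf (hs : IsBraidSeq s) (n : ℕ) :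
    ∑ x ∈ antidiagonal (n + 1), (-1) ^ x.2 * (halfTwist s x.1 x.2 * shuf s 0 x.1 x.2) = 0 := by
  have key : ∀ k l, halfTwist s (k + 1) l * ascProd s k l = halfTwist s k (l + 1) := by
    intro k l
    have : SemiconjBy (ascProd s k l) (halfTwist s k l) (halfTwist s (k + 1) l) := by
      refine semiconjBy_halfTwist fun b hb => ?_
      rw [add_right_comm]
      exact hs.semiconjBy_ascProd_shift (by omega) (by omega)
    rw [← this.eq, halfTwist]
  rw [sum_antidiagonal_succ_split
    (F := fun k l => (-1) ^ l * (halfTwist s k l * shuf s 0 k l))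
    (G := fun k l => (-1) ^ (l + 1) * (halfTwist s k (l + 1) * shuf s 0 k l))
    (H := fun k l => (-1) ^ l * (halfTwist s k (l + 1) * shuf s 0 k l)),
    ← sum_add_distrib]
  · exact sum_eq_zero fun x _ => by rw [pow_succ]; simp
  · intro k l
    rw [shuf_succ_succ, zero_add, mul_add, mul_add, ← mul_assoc (halfTwist s (k + 1) (l + 1)), key]
  · simp
  · intro k
    rw [← key]
    simp [ascProd]

/-- The left antipode identity: the same cancellation as in `sum_halfTwist_mul_shuf`, with the
first strand in place of the last one. -/
theorem sum_halfTwist_mul_shuf' (hs : IsBraidSeq s) (n : ℕ) :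
    ∑ x ∈ antidiagonal (n + 1), (-1) ^ x.1 * (halfTwist s 0 x.1 * shuf s 0 x.1 x.2) = 0 := by
  rw [sum_antidiagonal_succ_split
    (F := fun k l => (-1) ^ k * (halfTwist s 0 k * shuf s 0 k l))
    (G := fun k l => (-1) ^ k * (halfTwist s 0 (k + 1) * shuf s 1 k l))
    (H := fun k l => (-1) ^ (k + 1) * (halfTwist s 0 (k + 1) * shuf s 1 k l)),
    ← sum_add_distrib]
  · exact sum_eq_zero fun x _ => by rw [pow_succ]; simp
  · intro k l
    rw [hs.shuf_succ_succ', mul_add, mul_add, ← mul_assoc (halfTwist s 0 (k + 1)),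
      ← hs.halfTwist_succ', add_comm]
  · simp [halfTwist, ascProd]
  · simp

end IsBraidSeq

/-- The dual shuffle element, in which the generators are multiplied in the reverse order. -/
def dualShuf (s : ℕ → R) (a n m : ℕ) : R :=
  (shuf (fun b => MulOpposite.op (s b)) a n m).unop

@[simp] theorem dualShuf_zero_left (s : ℕ → R) (a m : ℕ) : dualShuf s a 0 m = 1 := by
  simp [dualShuf]

@[simp] theorem dualShuf_zero_right (s : ℕ → R) (a n : ℕ) : dualShuf s a n 0 = 1 := by
  simp [dualShuf]

theorem shuf_congr {n m : ℕ} (h : ∀ b, b + 1 < n + m → s (a + b) = s' (a' + b)) :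
    shuf s a n m = shuf s' a' n m := by
  simpa [SemiconjBy] using semiconjBy_shuf (x := 1) (s := s) (a := a) (s' := s') (a' := a')
    (n := n) (m := m) fun b hb => by simp [SemiconjBy, h b hb]

theorem dualShuf_congr {n m : ℕ} (h : ∀ b, b + 1 < n + m → s (a + b) = s' (a' + b)) :
    dualShuf s a n m = dualShuf s' a' n m :=
  congrArg MulOpposite.unop (shuf_congr fun b hb => congrArg MulOpposite.op (h b hb))

theorem map_dualShuf {R' : Type*} [Ring R'] (f : R →+* R') (s : ℕ → R) (a n m : ℕ) :
    f (dualShuf s a n m) = dualShuf (fun b => f (s b)) a n m :=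
  congrArg MulOpposite.unop (map_shuf f.op (fun b => MulOpposite.op (s b)) a n m)

namespace IsBraidSeq

theorem dualShuf_assoc (hs : IsBraidSeq s) (a n m l : ℕ) :
    dualShuf s a (n + m) l * dualShuf s a n m = dualShuf s a n (m + l) * dualShuf s (a + n) m l :=
  congrArg MulOpposite.unop (hs.op.shuf_coassoc a n m l)

/-- The identity `shuf_compat` in the opposite ring. There the sum runs over the decompositions of
`p` and `q`; arranging the four block sizes in a square and transposing it gives the sum over the
decompositions of `n` and `m`. -/
theorem dualShuf_compat (hs : IsBraidSeq s) (n m p q : ℕ) (h : p + q = n + m) :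
    dualShuf s 0 n m = ∑ x ∈ antidiagonal n, ∑ y ∈ antidiagonal m, if x.1 + y.1 = p then
      dualShuf s 0 x.1 y.1 * dualShuf s p x.2 y.2 * blockBraid s x.1 x.2 y.1 else 0 := by
  have h1 : dualShuf s 0 n m = ∑ x ∈ antidiagonal p, ∑ y ∈ antidiagonal q,
      if x.1 + y.1 = n then
        dualShuf s p y.1 y.2 * (dualShuf s 0 x.1 x.2 * blockBraid s x.1 y.1 x.2) else 0 := by
    rw [dualShuf, hs.op.shuf_compat p q n m h.symm]
    simp only [Finset.unop_sum]
    refine sum_congr rfl fun x _ => sum_congr rfl fun y _ => ?_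
    split_ifs
    · rw [MulOpposite.unop_mul, MulOpposite.unop_mul, hs.unop_blockBraid]
      rfl
    · rfl
  have h2 : ∀ i k j l, i + k = p → Commute (dualShuf s p j l) (dualShuf s 0 i k) := by
    intro i k j l hp
    have : Commute (shuf (fun b => MulOpposite.op (s b)) 0 i k)
        (shuf (fun b => MulOpposite.op (s b)) p j l) :=
      semiconjBy_shuf fun b hb => (hs.op.commute_shuf (by omega)).symm
    exact this.symm.unop
  rw [h1, ← sum_product', ← sum_product', ← sum_filter, ← sum_filter]
  refine sum_nbij' (fun z => ((z.1.1, z.2.1), (z.1.2, z.2.2)))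
    (fun z => ((z.1.1, z.2.1), (z.1.2, z.2.2))) ?_ ?_ ?_ ?_ ?_
  · rintro ⟨⟨i, k⟩, j, l⟩ hz
    simp only [mem_filter, mem_product, HasAntidiagonal.mem_antidiagonal] at hz ⊢
    omega
  · rintro ⟨⟨i, k⟩, j, l⟩ hz
    simp only [mem_filter, mem_product, HasAntidiagonal.mem_antidiagonal] at hz ⊢
    omega
  · intro _ _
    rfl
  · intro _ _
    rfl
  · rintro ⟨⟨i, k⟩, j, l⟩ hz
    simp only [mem_filter, mem_product, HasAntidiagonal.mem_antidiagonal] at hz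
    dsimp only
    rw [← mul_assoc, (h2 i k j l hz.1.1).eq]

theorem sum_dualShuf_mul_halfTwist (hs : IsBraidSeq s) (n : ℕ) :
    ∑ x ∈ antidiagonal (n + 1), (-1) ^ x.2 * (dualShuf s 0 x.1 x.2 * halfTwist s x.1 x.2) = 0 := by
  have h := congrArg MulOpposite.unop (hs.op.sum_halfTwist_mul_shuf n)
  simp only [Finset.unop_sum, MulOpposite.unop_mul, MulOpposite.unop_pow, MulOpposite.unop_neg,
    MulOpposite.unop_one, MulOpposite.unop_zero, hs.unop_halfTwist] at h
  rw [← h]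
  refine sum_congr rfl fun x _ => ?_
  rw [(((Commute.one_left _).neg_left).pow_left _).eq]
  rfl

theorem sum_dualShuf_mul_halfTwist' (hs : IsBraidSeq s) (n : ℕ) :
    ∑ x ∈ antidiagonal (n + 1), (-1) ^ x.1 * (dualShuf s 0 x.1 x.2 * halfTwist s 0 x.1) = 0 := by
  have h := congrArg MulOpposite.unop (hs.op.sum_halfTwist_mul_shuf' n)
  simp only [Finset.unop_sum, MulOpposite.unop_mul, MulOpposite.unop_pow, MulOpposite.unop_neg,
    MulOpposite.unop_one, MulOpposite.unop_zero, hs.unop_halfTwist] at h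
  rw [← h]
  refine sum_congr rfl fun x _ => ?_
  rw [(((Commute.one_left _).neg_left).pow_left _).eq]
  rfl

end IsBraidSeq

end ShuffleElements

/-! ### Reduced expressions of permutations -/

section PermutationLift

open Equiv

/-- The permutation of `N + 1` elements that maps the last element to `p` and the others to the
complement of `p` in the way `σ` prescribes. -/
def insertLast {N : ℕ} (p : Fin (N + 1)) (σ : Perm (Fin N)) : Perm (Fin (N + 1)) :=
  finSuccEquivLast.trans (σ.optionCongr.trans (finSuccEquiv' p).symm)

/-- The permutation of `N` elements that remains of a permutation of `N + 1` elements when the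
last element and its image are left out. -/
def removeLast {N : ℕ} (τ : Perm (Fin (N + 1))) : Perm (Fin N) :=
  removeNone (finSuccEquivLast.symm.trans (τ.trans (finSuccEquiv' (τ (Fin.last N)))))

@[simp] theorem insertLast_last {N : ℕ} (p : Fin (N + 1)) (σ : Perm (Fin N)) :
    insertLast p σ (Fin.last N) = p := by simp [insertLast]

@[simp] theorem insertLast_castSucc {N : ℕ} (p : Fin (N + 1)) (σ : Perm (Fin N)) (i : Fin N) :
    insertLast p σ i.castSucc = p.succAbove (σ i) := by simp [insertLast]

theorem insertLast_removeLast {N : ℕ} (τ : Perm (Fin (N + 1))) :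
    insertLast (τ (Fin.last N)) (removeLast τ) = τ := by
  ext i
  congr 1
  induction i using Fin.lastCases with
  | last => simp
  | cast i =>
    have h : τ i.castSucc ≠ τ (Fin.last N) := fun h => (Fin.castSucc_lt_last i).ne (τ.injective h)
    obtain ⟨j, hj⟩ := Fin.exists_succAbove_eq h
    have h1 : (finSuccEquivLast.symm.trans (τ.trans (finSuccEquiv' (τ (Fin.last N))))) (some i) =
        some j := by simp [← hj]
    have h2 := removeNone_some _ ⟨j, h1⟩
    rw [h1, Option.some_inj] at h2
    rw [insertLast_castSucc, removeLast, h2, hj]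

theorem insertLast_injective {N : ℕ} (p : Fin (N + 1)) : Function.Injective (insertLast p) := by
  intro σ σ' h
  ext i
  have := congrArg (fun τ : Perm (Fin (N + 1)) => τ i.castSucc) h
  rw [insertLast_castSucc, insertLast_castSucc] at this
  rw [Fin.succAbove_right_injective this]

@[simp] theorem removeLast_insertLast {N : ℕ} (p : Fin (N + 1)) (σ : Perm (Fin N)) :
    removeLast (insertLast p σ) = σ := by
  apply insertLast_injective p
  simpa using insertLast_removeLast (insertLast p σ)

theorem succAbove_val {N : ℕ} (p : Fin (N + 1)) (i : Fin N) :
    (p.succAbove i : ℕ) = if (i : ℕ) < p then (i : ℕ) else i + 1 := by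
  simp only [Fin.succAbove, Fin.lt_def, Fin.val_castSucc]
  split_ifs <;> rfl

theorem adjSwap_val {n : ℕ} (a : Fin (n - 1)) (i : Fin n) : (adjSwap n a i : ℕ) =
    if (i : ℕ) = a then (a : ℕ) + 1 else if (i : ℕ) = a + 1 then (a : ℕ) else i := by
  simp only [adjSwap, swap_apply_def, Fin.ext_iff]
  split_ifs <;> rfl

@[simp] theorem adjSwap_mul_self {n : ℕ} (a : Fin (n - 1)) : adjSwap n a * adjSwap n a = 1 :=
  swap_mul_self _ _

variable {M : Type*} [Monoid M] {s : ℕ → M}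

/-- The lift of a permutation to a monoid with a sequence `s` of elements: the last element, with
image `p`, contributes the factor `s p * ⋯ * s (N - 1)`. If `s` satisfies the braid relations
then every reduced expression of the permutation has this value, see
`IsReducedWord.prod_map_eq`. -/
def permLift (s : ℕ → M) : ∀ {N : ℕ}, Perm (Fin N) → M
  | 0, _ => 1
  | N + 1, τ => ascProd s (τ (Fin.last N)) (N - τ (Fin.last N)) * permLift s (removeLast τ)

theorem permLift_insertLast (s : ℕ → M) {N : ℕ} (p : Fin (N + 1)) (σ : Perm (Fin N)) :
    permLift s (insertLast p σ) = ascProd s p (N - p) * permLift s σ := by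
  rw [permLift, insertLast_last, removeLast_insertLast]

theorem permLift_one (s : ℕ → M) (N : ℕ) : permLift s (1 : Perm (Fin N)) = 1 := by
  induction N with
  | zero => rfl
  | succ N ih =>
    have : (1 : Perm (Fin (N + 1))) = insertLast (Fin.last N) 1 := by
      ext i
      induction i using Fin.lastCases <;> simp
    rw [this, permLift_insertLast, ih]
    simp [ascProd]

theorem permLift_revPerm (s : ℕ → M) (N : ℕ) :
    permLift s (Fin.revPerm : Perm (Fin N)) = halfTwist s 0 N := by
  induction N with
  | zero => rfl
  | succ N ih =>
    have : (Fin.revPerm : Perm (Fin (N + 1))) = insertLast 0 Fin.revPerm := by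
      ext i
      induction i using Fin.lastCases <;> simp [Fin.rev_castSucc]
    rw [this, permLift_insertLast, ih]
    rfl

/-- If the neighbour transposition `t_a` increases the length of `σ`, then the lift of `t_a σ` is
`s a` times the lift of `σ`. -/
theorem IsBraidSeq.permLift_adjSwap_mul (hs : IsBraidSeq s) {N : ℕ} (a : Fin (N - 1))
    (σ : Perm (Fin N)) (h : ∀ i j, (σ i : ℕ) = a → (σ j : ℕ) = a + 1 → i < j) :
    permLift s (adjSwap N a * σ) = s a * permLift s σ := by
  induction N with
  | zero => exact a.elim0
  | succ N ih =>
    obtain ⟨p, σ, rfl⟩ : ∃ p σ', insertLast p σ' = σ := ⟨_, _, insertLast_removeLast σ⟩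
    have ha : (a : ℕ) < N := a.2
    have hp : (p : ℕ) < N + 1 := p.2
    rcases lt_or_ge (p : ℕ) a with hpa | hpa
    · -- the positions `a`, `a + 1` hold the values `a - 1`, `a` of `σ`
      have e : adjSwap (N + 1) a * insertLast p σ =
          insertLast p (adjSwap N ⟨a - 1, by omega⟩ * σ) := by
        ext i
        induction i using Fin.lastCases with
        | last => simp only [Perm.mul_apply, insertLast_last, adjSwap_val]; split_ifs <;> omega
        | cast i =>
          simp only [Perm.mul_apply, insertLast_castSucc, adjSwap_val, succAbove_val]
          split_ifs <;> omega
      rw [e, permLift_insertLast, permLift_insertLast, ih, ← mul_assoc, ← mul_assoc,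
        (hs.semiconjBy_ascProd_shift (by dsimp only; omega) (by dsimp only; omega)).eq]
      · dsimp only
        rw [Nat.sub_add_cancel (by omega)]
      · intro i j hi hj
        have := h i.castSucc j.castSucc
        simp only [insertLast_castSucc, succAbove_val, hi, hj, Fin.castSucc_lt_castSucc_iff] at this
        apply this <;> split_ifs <;> omega
    rcases eq_or_ne (p : ℕ) a with hpa' | hpa'
    · -- the value `a` at the last element comes after the value `a + 1`
      exfalso
      obtain ⟨j, hj⟩ := (insertLast p σ).surjective ⟨a + 1, by omega⟩
      exact (Fin.le_last j).not_gt (h (Fin.last N) j (by simpa using hpa') (by rw [hj]))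
    rcases eq_or_ne (p : ℕ) (a + 1) with hpa'' | hpa''
    · have e : adjSwap (N + 1) a * insertLast p σ = insertLast ⟨a, by omega⟩ σ := by
        ext i
        induction i using Fin.lastCases with
        | last => simp only [Perm.mul_apply, insertLast_last, adjSwap_val]; split_ifs <;> omega
        | cast i =>
          simp only [Perm.mul_apply, insertLast_castSucc, adjSwap_val, succAbove_val]
          split_ifs <;> omega
      rw [e, permLift_insertLast, permLift_insertLast, ← mul_assoc, hpa'',
        show N - ((⟨a, by omega⟩ : Fin (N + 1)) : ℕ) = N - (a + 1) + 1 by dsimp only; omega,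
        ascProd_succ']
    · have e : adjSwap (N + 1) a * insertLast p σ =
          insertLast p (adjSwap N ⟨a, by omega⟩ * σ) := by
        ext i
        induction i using Fin.lastCases with
        | last => simp only [Perm.mul_apply, insertLast_last, adjSwap_val]; split_ifs <;> omega
        | cast i =>
          simp only [Perm.mul_apply, insertLast_castSucc, adjSwap_val, succAbove_val]
          split_ifs <;> omega
      have c : Commute (s a) (ascProd s p (N - p)) :=
        semiconjBy_ascProd fun b _ => hs.comm _ _ (by omega)
      rw [e, permLift_insertLast, permLift_insertLast, ih, ← mul_assoc, ← mul_assoc, c.eq]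
      intro i j hi hj
      have := h i.castSucc j.castSucc
      simp only [insertLast_castSucc, succAbove_val, hi, hj, Fin.castSucc_lt_castSucc_iff] at this
      apply this <;> split_ifs <;> omega

/-- The length of a permutation, counted in its normal form: `permLift` for the constant sequence in
the free monoid on one generator. -/
def normalLength {N : ℕ} (σ : Perm (Fin N)) : ℕ :=
  (permLift (fun _ => Multiplicative.ofAdd 1) σ).toAdd

theorem normalLength_adjSwap_mul {N : ℕ} (a : Fin (N - 1)) (σ : Perm (Fin N))
    (h : ∀ i j, (σ i : ℕ) = a → (σ j : ℕ) = a + 1 → i < j) :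
    normalLength (adjSwap N a * σ) = normalLength σ + 1 := by
  have hs : IsBraidSeq fun _ : ℕ => Multiplicative.ofAdd 1 := ⟨fun _ _ _ => rfl, fun _ => rfl⟩
  rw [normalLength, hs.permLift_adjSwap_mul a σ h, toAdd_mul, add_comm]
  rfl

theorem normalLength_of_descent {N : ℕ} (a : Fin (N - 1)) (σ : Perm (Fin N))
    (h : ¬ ∀ i j, (σ i : ℕ) = a → (σ j : ℕ) = a + 1 → i < j) :
    normalLength σ = normalLength (adjSwap N a * σ) + 1 := by
  rw [← normalLength_adjSwap_mul a, ← mul_assoc, adjSwap_mul_self, one_mul]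
  push Not at h
  obtain ⟨i, j, hi, hj, hij⟩ := h
  intro i' j' hi' hj'
  have h1 : i' = j := σ.injective (Fin.ext (by
    rw [Perm.mul_apply, adjSwap_val] at hi'; split_ifs at hi' <;> omega))
  have h2 : j' = i := σ.injective (Fin.ext (by
    rw [Perm.mul_apply, adjSwap_val] at hj'; split_ifs at hj' <;> omega))
  rw [h1, h2]
  refine lt_of_le_of_ne hij ?_
  rintro rfl
  omega

theorem wordPerm_cons {N : ℕ} (a : Fin (N - 1)) (w : List (Fin (N - 1))) :
    wordPerm (a :: w) = adjSwap N a * wordPerm w := by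
  simp [wordPerm]

theorem normalLength_wordPerm_le {N : ℕ} (w : List (Fin (N - 1))) :
    normalLength (wordPerm w) ≤ w.length := by
  induction w with
  | nil => simp [normalLength, wordPerm, permLift_one]
  | cons a w ih =>
    rw [wordPerm_cons, List.length_cons]
    by_cases h : ∀ i j, (wordPerm w i : ℕ) = a → (wordPerm w j : ℕ) = a + 1 → i < j
    · rw [normalLength_adjSwap_mul a _ h]; omega
    · have := normalLength_of_descent a _ h; omega

theorem eq_one_of_strictMono {N : ℕ} {σ : Perm (Fin N)} (h : StrictMono σ) : σ = 1 := by
  have := Subsingleton.elim (h.orderIsoOfSurjective σ σ.surjective) (OrderIso.refl _)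
  ext i
  exact congrArg (fun e : Fin N ≃o Fin N => (e i : ℕ)) this

theorem exists_word_length_eq_normalLength {N : ℕ} (σ : Perm (Fin N)) :
    ∃ w, wordPerm w = σ ∧ w.length = normalLength σ := by
  induction hl : normalLength σ generalizing σ with
  | zero =>
    refine ⟨[], ?_, rfl⟩
    have h : ∀ a : Fin (N - 1), ∀ i j, (σ i : ℕ) = a → (σ j : ℕ) = a + 1 → i < j := by
      intro a
      by_contra h
      have := normalLength_of_descent a σ h
      omega
    cases N with
    | zero => exact Subsingleton.elim _ _
    | succ N =>
      have hm : StrictMono (σ⁻¹ : Perm (Fin (N + 1))) :=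
        Fin.strictMono_iff_lt_succ.2 fun i => h i _ _ (by simp) (by simp)
      rw [← inv_inv σ, eq_one_of_strictMono hm]
      rfl
  | succ l ih =>
    obtain ⟨a, ha⟩ : ∃ a : Fin (N - 1),
        ¬ ∀ i j, (σ i : ℕ) = a → (σ j : ℕ) = a + 1 → i < j := by
      by_contra! h
      cases N with
      | zero => rw [Subsingleton.elim σ 1, normalLength, permLift_one] at hl; simp at hl
      | succ N =>
        have hm : StrictMono (σ⁻¹ : Perm (Fin (N + 1))) :=
          Fin.strictMono_iff_lt_succ.2 fun i => h i _ _ (by simp) (by simp)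
        rw [← inv_inv σ, eq_one_of_strictMono hm, inv_one, normalLength, permLift_one] at hl
        simp at hl
    have h1 := normalLength_of_descent a σ ha
    obtain ⟨w, hw, hw'⟩ := ih (adjSwap N a * σ) (by omega)
    refine ⟨a :: w, ?_, by simp [hw']⟩
    rw [wordPerm_cons, hw, ← mul_assoc, adjSwap_mul_self, one_mul]

theorem IsReducedWord.length_eq {N : ℕ} {w : List (Fin (N - 1))} (hw : IsReducedWord w) :
    w.length = normalLength (wordPerm w) := by
  obtain ⟨w', h, h'⟩ := exists_word_length_eq_normalLength (wordPerm w)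
  exact le_antisymm (h' ▸ hw w' h) (normalLength_wordPerm_le w)

theorem isReducedWord_of_length_eq {N : ℕ} {w : List (Fin (N - 1))}
    (hw : w.length = normalLength (wordPerm w)) : IsReducedWord w := by
  intro w' h
  rw [hw, ← h]
  exact normalLength_wordPerm_le w'

/-- All reduced expressions of a permutation have the same value in a monoid in which the braid
relations hold. -/
theorem IsReducedWord.prod_map_eq {N : ℕ} {w : List (Fin (N - 1))} (hw : IsReducedWord w)
    (hs : IsBraidSeq s) : (w.map fun a : Fin (N - 1) => s a).prod = permLift s (wordPerm w) := by
  induction w with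
  | nil => exact (permLift_one s N).symm
  | cons a w ih =>
    have h1 := hw.length_eq
    have h2 := normalLength_wordPerm_le w
    rw [wordPerm_cons, List.length_cons] at h1
    have h3 : ∀ i j, (wordPerm w i : ℕ) = a → (wordPerm w j : ℕ) = a + 1 → i < j := by
      by_contra h
      have := normalLength_of_descent a _ h
      omega
    rw [wordPerm_cons, hs.permLift_adjSwap_mul a _ h3, List.map_cons, List.prod_cons, ih]
    have := normalLength_adjSwap_mul a _ h3
    exact isReducedWord_of_length_eq (by omega)

theorem wordPerm_reducedWord {N : ℕ} (σ : Perm (Fin N)) : wordPerm (reducedWord σ) = σ :=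
  (exists_isReducedWord σ).choose_spec.1

theorem isReducedWord_reducedWord {N : ℕ} (σ : Perm (Fin N)) : IsReducedWord (reducedWord σ) :=
  (exists_isReducedWord σ).choose_spec.2

theorem IsBraidSeq.prod_map_reducedWord (hs : IsBraidSeq s) {N : ℕ} (σ : Perm (Fin N)) :
    ((reducedWord σ).map fun a : Fin (N - 1) => s a).prod = permLift s σ := by
  rw [(isReducedWord_reducedWord σ).prod_map_eq hs, wordPerm_reducedWord]

theorem wordPerm_reverse {N : ℕ} (w : List (Fin (N - 1))) :
    wordPerm w.reverse = (wordPerm w)⁻¹ := by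
  rw [wordPerm, wordPerm, List.prod_inv_reverse, List.map_reverse, List.map_map]
  congr 3

theorem IsBraidSeq.permLift_inv (hs : IsBraidSeq s) {N : ℕ} (σ : Perm (Fin N)) :
    permLift s σ⁻¹ = (permLift (fun a => MulOpposite.op (s a)) σ).unop := by
  have hr : IsReducedWord (reducedWord σ).reverse := by
    intro w' h
    rw [wordPerm_reverse] at h
    rw [List.length_reverse, ← w'.length_reverse]
    apply isReducedWord_reducedWord σ
    rw [wordPerm_reverse, h, inv_inv]
  have h := hr.prod_map_eq hs
  rw [wordPerm_reverse, wordPerm_reducedWord] at h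
  rw [← h, ← hs.op.prod_map_reducedWord, MulOpposite.unop_list_prod, List.map_reverse,
    List.map_map]
  rfl

end PermutationLift

/-! ### Sums over shuffle permutations -/

section Shuffles

open Equiv Finset

/-- The shuffle permutations of `N` elements with a first block of `n` elements. -/
def shufflePerms (N n : ℕ) : Finset (Perm (Fin N)) :=
  {σ | ∀ a b, a < b → ((σ a : ℕ) < n ↔ (σ b : ℕ) < n) → σ a < σ b}

theorem mem_shufflePerms {N n : ℕ} {σ : Perm (Fin N)} : σ ∈ shufflePerms N n ↔
    ∀ a b, a < b → ((σ a : ℕ) < n ↔ (σ b : ℕ) < n) → σ a < σ b := by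
  simp [shufflePerms]

theorem shufflePerms_eq_singleton {N n : ℕ} (h : n = 0 ∨ N ≤ n) : shufflePerms N n = {1} := by
  ext σ
  rw [mem_shufflePerms, mem_singleton]
  constructor
  · intro hσ
    refine eq_one_of_strictMono fun a b hab => hσ a b hab ?_
    have := (σ a).2
    have := (σ b).2
    omega
  · rintro rfl a b hab _
    exact hab

/-- In a shuffle permutation the last element is mapped to the end of the first or of the second
block, and the other elements are mapped by a shuffle permutation. -/
theorem shufflePerms_succ (N n : ℕ) (h : n < N) : shufflePerms (N + 1) (n + 1) =
    (shufflePerms N (n + 1)).image (insertLast (Fin.last N)) ∪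
      (shufflePerms N n).image (insertLast ⟨n, by omega⟩) := by
  ext τ
  obtain ⟨p, σ, rfl⟩ : ∃ p σ', insertLast p σ' = τ := ⟨_, _, insertLast_removeLast τ⟩
  have hmem : ∀ q : Fin (N + 1), ∀ k, insertLast p σ ∈ (shufflePerms N k).image (insertLast q) ↔
      p = q ∧ σ ∈ shufflePerms N k := by
    intro q k
    rw [mem_image]
    constructor
    · rintro ⟨σ', hσ', h⟩
      have hq : q = p := by simpa using congrArg (fun τ : Perm _ => τ (Fin.last N)) h
      subst hq
      exact ⟨rfl, insertLast_injective _ h ▸ hσ'⟩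
    · rintro ⟨rfl, hσ⟩
      exact ⟨σ, hσ, rfl⟩
  rw [mem_union, hmem, hmem]
  simp only [mem_shufflePerms]
  constructor
  · intro hτ
    -- the last element is mapped to the end of its block
    have hend : ∀ q : Fin (N + 1), p < q → ((q : ℕ) < n + 1 ↔ (p : ℕ) < n + 1) → False := by
      intro q hpq hq
      obtain ⟨b, hb⟩ := (insertLast p σ).surjective q
      have hbl : b ≠ Fin.last N := by
        rintro rfl
        rw [insertLast_last] at hb
        exact hpq.ne hb
      have := hτ b (Fin.last N) (Fin.lt_last_iff_ne_last.2 hbl) (by rwa [hb, insertLast_last])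
      rw [hb, insertLast_last] at this
      exact this.not_gt hpq
    have hp2 := p.2
    rcases lt_or_ge (p : ℕ) (n + 1) with hp | hp
    · right
      have hpn : (p : ℕ) = n := by
        by_contra hne
        exact hend ⟨n, by omega⟩ (by rw [Fin.lt_def]; dsimp only; omega) (by dsimp only; omega)
      refine ⟨Fin.ext hpn, fun a b hab hiff => ?_⟩
      have := hτ a.castSucc b.castSucc (by simpa using hab)
      simp only [insertLast_castSucc, Fin.succAbove_lt_succAbove_iff] at this
      refine this ?_
      rw [succAbove_val, succAbove_val, hpn]
      split_ifs <;> omega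
    · left
      have hpN : (p : ℕ) = N := by
        by_contra hne
        exact hend (Fin.last N) (by rw [Fin.lt_def, Fin.val_last]; omega)
          (by rw [Fin.val_last]; omega)
      refine ⟨Fin.ext hpN, fun a b hab hiff => ?_⟩
      have := hτ a.castSucc b.castSucc (by simpa using hab)
      simp only [insertLast_castSucc, Fin.succAbove_lt_succAbove_iff] at this
      refine this ?_
      have := (σ a).2
      have := (σ b).2
      rw [succAbove_val, succAbove_val, hpN]
      split_ifs
      exact hiff
  · rintro (⟨rfl, hσ⟩ | ⟨rfl, hσ⟩) a b hab
    · induction a using Fin.lastCases with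
      | last => exact absurd hab (Fin.le_last b).not_gt
      | cast a =>
        induction b using Fin.lastCases with
        | last =>
          intro _
          rw [insertLast_last, insertLast_castSucc, Fin.succAbove_last]
          exact Fin.castSucc_lt_last _
        | cast b =>
          simp only [insertLast_castSucc, Fin.succAbove_last, Fin.val_castSucc,
            Fin.castSucc_lt_castSucc_iff] at hab ⊢
          exact hσ a b hab
    · induction a using Fin.lastCases with
      | last => exact absurd hab (Fin.le_last b).not_gt
      | cast a =>
        induction b using Fin.lastCases with
        | last =>
          rw [insertLast_last, insertLast_castSucc, Fin.lt_def, succAbove_val]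
          dsimp only
          split_ifs <;> omega
        | cast b =>
          simp only [insertLast_castSucc, Fin.castSucc_lt_castSucc_iff] at hab ⊢
          rw [Fin.succAbove_lt_succAbove_iff, succAbove_val, succAbove_val]
          intro hiff
          refine hσ a b hab ?_
          dsimp only at hiff
          split_ifs at hiff <;> omega

variable {R : Type*} [Ring R]

/-- The sum of the lifts of the shuffle permutations is the shuffle element. -/
theorem sum_permLift_shufflePerms (s : ℕ → R) {N n m : ℕ} (h : n + m = N) :
    ∑ σ ∈ shufflePerms N n, permLift s σ = shuf s 0 n m := by
  induction N generalizing n m with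
  | zero =>
    obtain rfl : n = 0 := by omega
    rw [shufflePerms_eq_singleton (Or.inl rfl), sum_singleton, permLift_one, shuf_zero_left]
  | succ N ih =>
    rcases n with - | n
    · rw [shufflePerms_eq_singleton (Or.inl rfl), sum_singleton, permLift_one, shuf_zero_left]
    rcases m with - | m
    · rw [shufflePerms_eq_singleton (Or.inr (by omega)), sum_singleton, permLift_one,
        shuf_zero_right]
    rw [shufflePerms_succ N n (by omega), sum_union, sum_image (insertLast_injective _).injOn,
      sum_image (insertLast_injective _).injOn, shuf_succ_succ, ← ih (by omega),
      ← ih (n := n) (m := m + 1) (by omega), mul_sum]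
    · congr 1
      · refine sum_congr rfl fun σ _ => ?_
        rw [permLift_insertLast, Fin.val_last, Nat.sub_self, ascProd, one_mul]
      · refine sum_congr rfl fun σ _ => ?_
        rw [permLift_insertLast, zero_add, show N - n = m + 1 by omega]
    · rw [disjoint_left]
      intro τ h1 h2
      obtain ⟨σ₁, -, rfl⟩ := mem_image.1 h1
      obtain ⟨σ₂, -, h2⟩ := mem_image.1 h2
      have := congrArg (fun τ : Perm (Fin (N + 1)) => (τ (Fin.last N) : ℕ)) h2
      simp only [insertLast_last, Fin.val_last] at this
      omega

theorem sum_permLift_shuffles (s : ℕ → R) (n m : ℕ) :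
    ∑ σ ∈ shuffles n m, permLift s σ = shuf s 0 n m :=
  sum_permLift_shufflePerms s rfl

/-- Inverting a permutation reverses its reduced expressions, so that the inverse shuffles give the
dual shuffle element. -/
theorem sum_permLift_inverseShuffles {s : ℕ → R} (hs : IsBraidSeq s) (n m : ℕ) :
    ∑ σ ∈ inverseShuffles n m, permLift s σ = dualShuf s 0 n m := by
  rw [dualShuf, ← sum_permLift_shuffles, Finset.unop_sum]
  refine sum_nbij' (fun σ => σ⁻¹) (fun σ => σ⁻¹) ?_ ?_ ?_ ?_ ?_
  · intro σ hσ
    simpa [inverseShuffles] using hσ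
  · intro σ hσ
    simpa [inverseShuffles] using hσ
  · intro σ _
    exact inv_inv σ
  · intro σ _
    exact inv_inv σ
  · intro σ _
    rw [← hs.permLift_inv, inv_inv]

end Shuffles

/-! ### Concatenation of tensor powers -/

section Concatenation

variable {C : Type u} [Category.{v} C] [MonoidalCategory C]

/-- The canonical isomorphism `X^i ⊗ X^j ≅ X^N` for `i + j = N`. -/
def concatTo (X : C) (i j N : ℕ) (h : i + j = N) :
    tensorPow X i ⊗ tensorPow X j ≅ tensorPow X N :=
  concat X i j ≪≫ eqToIso (by rw [h])

theorem concatTo_rfl (X : C) (i j : ℕ) : concatTo X i j (i + j) rfl = concat X i j := by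
  simp [concatTo]

theorem concatTo_zero (X : C) (i : ℕ) : concatTo X i 0 i rfl = ρ_ (tensorPow X i) :=
  concatTo_rfl X i 0

theorem concatTo_succ (X : C) (i j N : ℕ) (h : i + j = N) :
    concatTo X i (j + 1) (N + 1) (by omega) =
      (α_ (tensorPow X i) (tensorPow X j) X).symm ≪≫ whiskerRightIso (concatTo X i j N h) X := by
  subst h
  rw [concatTo_rfl]
  exact concatTo_rfl X i (j + 1)

theorem concatTo_succ_hom (X : C) (i j N : ℕ) (h : i + j = N) :
    (concatTo X i (j + 1) (N + 1) (by omega)).hom =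
      (α_ (tensorPow X i) (tensorPow X j) X).inv ≫ (concatTo X i j N h).hom ▷ X := by
  rw [concatTo_succ X i j N h]
  rfl

theorem concatTo_zero_left (X : C) (j : ℕ) :
    (concatTo X 0 j j (zero_add j)).hom = (λ_ (tensorPow X j)).hom := by
  induction j with
  | zero => rw [concatTo_zero]; exact unitors_equal.symm
  | succ j ih =>
    rw [concatTo_succ_hom X 0 j j (zero_add j), ih]
    exact (leftUnitor_tensor_hom (tensorPow X j) X).symm

theorem concatTo_one (X : C) (k : ℕ) :
    (concatTo X k 1 (k + 1) rfl).hom = tensorPow X k ◁ (λ_ X).hom := by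
  rw [concatTo_succ_hom X k 0 k rfl, concatTo_zero]
  exact triangle_assoc_comp_right (tensorPow X k) X

/-- The induction step for `concatTo_assoc`, with arbitrary morphisms in place of the canonical
isomorphisms. -/
theorem assoc_step {A B K L M N X : C} {a : A ⊗ B ⟶ N} {b : N ⊗ K ⟶ M} {c : B ⊗ K ⟶ L}
    {d : A ⊗ L ⟶ M} (h : a ▷ K ≫ b = (α_ A B K).hom ≫ A ◁ c ≫ d) :
    a ▷ (K ⊗ X) ≫ (α_ N K X).inv ≫ b ▷ X =
      (α_ A B (K ⊗ X)).hom ≫ A ◁ ((α_ B K X).inv ≫ c ▷ X) ≫ (α_ A L X).inv ≫ d ▷ X := by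
  have := congrArg (· ▷ X) h
  simp only [comp_whiskerRight] at this
  rw [associator_inv_naturality_left_assoc, this]
  simp

/-- Associativity of concatenation. -/
theorem concatTo_assoc (X : C) (i j k n m N : ℕ) (hn : i + j = n) (hm : j + k = m)
    (hN : n + k = N) (hN' : i + m = N) :
    (concatTo X i j n hn).hom ▷ tensorPow X k ≫ (concatTo X n k N hN).hom =
      (α_ _ _ _).hom ≫ tensorPow X i ◁ (concatTo X j k m hm).hom ≫
        (concatTo X i m N hN').hom := by
  induction k generalizing m N with
  | zero =>
    obtain rfl : j = m := hm
    obtain rfl : n = N := hN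
    rw [concatTo_zero, concatTo_zero]
    refine (rightUnitor_naturality (concatTo X i j n hn).hom).trans ?_
    rw [rightUnitor_tensor_hom, Category.assoc]
    rfl
  | succ k ih =>
    obtain rfl : j + k + 1 = m := by omega
    obtain rfl : n + k + 1 = N := by omega
    rw [concatTo_succ_hom X n k (n + k) rfl, concatTo_succ_hom X j k (j + k) rfl,
      concatTo_succ_hom X i (j + k) (n + k) (by omega)]
    exact assoc_step (ih (j + k) (n + k) rfl rfl (by omega))

/-- The canonical morphism `X ⊗ X^n ⟶ X^(n + 1)`. -/
def consHom (X : C) (n : ℕ) : X ⊗ tensorPow X n ⟶ tensorPow X (n + 1) :=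
  (λ_ X).inv ▷ tensorPow X n ≫ (concatTo X 1 n (n + 1) (add_comm 1 n)).hom

theorem consHom_succ (X : C) (n : ℕ) :
    consHom X (n + 1) = (α_ X (tensorPow X n) X).inv ≫ consHom X n ▷ X := by
  rw [consHom, concatTo_succ_hom X 1 n (n + 1) (add_comm 1 n), consHom]
  have : ∀ {P Q K L : C} (f : P ⟶ Q) (g : Q ⊗ K ⟶ L),
      f ▷ (K ⊗ X) ≫ (α_ Q K X).inv ≫ g ▷ X = (α_ P K X).inv ≫ (f ▷ K ≫ g) ▷ X := by
    intro P Q K L f g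
    rw [associator_inv_naturality_left_assoc, comp_whiskerRight]
  exact this _ _

/-- Concatenation when the last of the first `k + 1` factors is moved over to the second block. -/
theorem concatTo_succ_left (X : C) (k j N : ℕ) (h : k + (j + 1) = N) :
    (concatTo X (k + 1) j N (by omega)).hom = (α_ (tensorPow X k) X (tensorPow X j)).hom ≫
      tensorPow X k ◁ consHom X j ≫ (concatTo X k (j + 1) N h).hom := by
  have h1 := concatTo_assoc X k 1 j (k + 1) (j + 1) N rfl (add_comm 1 j) (by omega) h
  rw [concatTo_one] at h1
  have h2 : ∀ {P Q J M N : C} (f : (P ⊗ X) ⊗ J ⟶ M) (g : Q ⊗ J ⟶ N) (k : P ⊗ N ⟶ M)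
      (e : Q ≅ X), (P ◁ e.hom) ▷ J ≫ f = (α_ P Q J).hom ≫ P ◁ g ≫ k →
      f = (α_ P X J).hom ≫ P ◁ (e.inv ▷ J ≫ g) ≫ k := by
    intro P Q J M N f g k e he
    rw [← cancel_epi ((P ◁ e.hom) ▷ J), he, associator_naturality_middle_assoc,
      ← whiskerLeft_comp_assoc, hom_inv_whiskerRight_assoc]
  exact h2 _ _ _ (λ_ X) h1

/-- Concatenation of four blocks, starting with the two middle ones. -/
theorem concatTo_tensor (X : C) (i j k l n m r t N : ℕ) (hn : i + j = n) (hm : k + l = m)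
    (hr : j + k = r) (ht : r + l = t) (hN : n + m = N) (hN' : i + t = N) :
    ((concatTo X i j n hn).hom ⊗ₘ (concatTo X k l m hm).hom) ≫ (concatTo X n m N hN).hom =
      (α_ _ _ _).hom ≫ tensorPow X i ◁ ((α_ _ _ _).inv ≫
        (concatTo X j k r hr).hom ▷ tensorPow X l ≫ (concatTo X r l t ht).hom) ≫
          (concatTo X i t N hN').hom := by
  have h1 := concatTo_assoc X i j m n t N hn (by omega) hN hN'
  have h2 := concatTo_assoc X j k l r m t hr hm ht (by omega)
  rw [MonoidalCategory.tensorHom_def', Category.assoc, h1, associator_naturality_right_assoc,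
    ← whiskerLeft_comp_assoc, h2, Iso.inv_hom_id_assoc]

end Concatenation

/-! ### The braid relations for the elementary braidings -/

section BraidGenerators

variable {C : Type u} [Category.{v} C] [MonoidalCategory C]

theorem whiskerRight_comm_braiding {P X : C} (f : P ⟶ P) (g : X ⊗ X ⟶ X ⊗ X) :
    f ▷ X ▷ X ≫ (α_ P X X).hom ≫ P ◁ g ≫ (α_ P X X).inv =
      ((α_ P X X).hom ≫ P ◁ g ≫ (α_ P X X).inv) ≫ f ▷ X ▷ X := by
  rw [associator_naturality_left_assoc, ← whisker_exchange_assoc, associator_inv_naturality_left]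
  simp only [Category.assoc]

variable [BraidedCategory C]

/-- The braid relation for the braiding of three adjacent factors, behind a further factor `P`. -/
theorem braid_relation (P X : C) :
    ((α_ P X X).hom ≫ P ◁ (β_ X X).hom ≫ (α_ P X X).inv) ▷ X ≫
      ((α_ (P ⊗ X) X X).hom ≫ (P ⊗ X) ◁ (β_ X X).hom ≫ (α_ (P ⊗ X) X X).inv) ≫
        ((α_ P X X).hom ≫ P ◁ (β_ X X).hom ≫ (α_ P X X).inv) ▷ X =
    ((α_ (P ⊗ X) X X).hom ≫ (P ⊗ X) ◁ (β_ X X).hom ≫ (α_ (P ⊗ X) X X).inv) ≫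
      ((α_ P X X).hom ≫ P ◁ (β_ X X).hom ≫ (α_ P X X).inv) ▷ X ≫
        ((α_ (P ⊗ X) X X).hom ≫ (P ⊗ X) ◁ (β_ X X).hom ≫ (α_ (P ⊗ X) X X).inv) := by
  let e : ((P ⊗ X) ⊗ X) ⊗ X ≅ P ⊗ X ⊗ X ⊗ X := α_ (P ⊗ X) X X ≪≫ α_ P X (X ⊗ X)
  have hx : ((α_ P X X).hom ≫ P ◁ (β_ X X).hom ≫ (α_ P X X).inv) ▷ X =
      e.hom ≫ P ◁ ((α_ X X X).inv ≫ (β_ X X).hom ▷ X ≫ (α_ X X X).hom) ≫ e.inv := by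
    simp only [e, Iso.trans_hom, Iso.trans_inv]
    monoidal
  have hy : (α_ (P ⊗ X) X X).hom ≫ (P ⊗ X) ◁ (β_ X X).hom ≫ (α_ (P ⊗ X) X X).inv =
      e.hom ≫ P ◁ (X ◁ (β_ X X).hom) ≫ e.inv := by
    simp only [e, Iso.trans_hom, Iso.trans_inv]
    monoidal
  rw [hx, hy]
  simp only [Category.assoc, Iso.inv_hom_id_assoc]
  congr 1
  simp only [← whiskerLeft_comp_assoc, Category.assoc]
  congr 2
  simpa only [Category.assoc] using BraidedCategory.yang_baxter X X X

theorem braidGen_last (X : C) (n : ℕ) : braidGen X (n + 2) n = braidLast X n := by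
  simp [braidGen]

theorem braidGen_succ (X : C) {N a : ℕ} (h : a + 1 < N) :
    braidGen X (N + 1) a = braidGen X N a ▷ X := by
  obtain ⟨n, rfl⟩ : ∃ n, N = n + 1 := ⟨N - 1, by omega⟩
  exact if_neg (by omega)

theorem braidGen_comm (X : C) {N a b : ℕ} (hab : a + 2 ≤ b) (hb : b + 1 < N) :
    braidGen X N a ≫ braidGen X N b = braidGen X N b ≫ braidGen X N a := by
  induction N with
  | zero => omega
  | succ N ih =>
    by_cases h : b + 1 < N
    · rw [braidGen_succ X h, braidGen_succ X (show a + 1 < N by omega)]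
      exact (comp_whiskerRight _ _ X).symm.trans ((congrArg (· ▷ X) (ih h)).trans
        (comp_whiskerRight _ _ X))
    · obtain rfl : N = b + 1 := by omega
      rw [braidGen_last, braidGen_succ X (show a + 1 < b + 1 by omega),
        braidGen_succ X (show a + 1 < b by omega)]
      exact whiskerRight_comm_braiding (braidGen X b a) (β_ X X).hom

theorem braidGen_braid (X : C) {N a : ℕ} (ha : a + 2 < N) :
    braidGen X N a ≫ braidGen X N (a + 1) ≫ braidGen X N a =
      braidGen X N (a + 1) ≫ braidGen X N a ≫ braidGen X N (a + 1) := by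
  induction N with
  | zero => omega
  | succ N ih =>
    by_cases h : a + 2 < N
    · rw [braidGen_succ X (show a + 1 < N by omega), braidGen_succ X h]
      have := congrArg (· ▷ X) (ih h)
      simp only [comp_whiskerRight] at this
      exact this
    · obtain rfl : N = a + 2 := by omega
      rw [braidGen_last, braidGen_succ X (show a + 1 < a + 2 by omega), braidGen_last]
      exact braid_relation (tensorPow X a) X

end BraidGenerators

/-! ### Endomorphisms of tensor powers acting on a part of the factors -/

section StrandAlgebra

variable {C : Type u} [Category.{v} C] [MonoidalCategory C]

@[simp] theorem scalar_one (X : C) : (scalar (1 : Aut (𝟙_ C)) X).hom = 𝟙 X := by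
  change (λ_ X).inv ≫ (𝟙 (𝟙_ C)) ▷ X ≫ (λ_ X).hom = _
  simp

/-- The scalar `lam` as an element of the ring of endomorphisms. -/
def scalarEnd (lam : Aut (𝟙_ C)) (Y : C) : End Y := (scalar lam Y).hom

theorem commute_scalarEnd (lam : Aut (𝟙_ C)) {Y : C} (f : End Y) : Commute (scalarEnd lam Y) f :=
  (scalar_naturality lam f).symm

theorem scalar_pow_hom (lam : Aut (𝟙_ C)) (k : ℕ) (Y : C) :
    (scalar (lam ^ k) Y).hom = scalarEnd lam Y ^ k := by
  induction k with
  | zero => simp only [pow_zero, scalar_one]; rfl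
  | succ k ih =>
    rw [pow_succ, scalar_mul, ih, pow_succ]
    rfl

/-- A braiding of the last two factors stays one when further factors are put in front. -/
theorem whiskerLeft_braid_comp {P Q K X : C} (e : P ⊗ Q ⟶ K) (b : X ⊗ X ⟶ X ⊗ X) :
    P ◁ ((α_ Q X X).hom ≫ Q ◁ b ≫ (α_ Q X X).inv) ≫
        (α_ P (Q ⊗ X) X).inv ≫ ((α_ P Q X).inv ≫ e ▷ X) ▷ X =
      ((α_ P (Q ⊗ X) X).inv ≫ ((α_ P Q X).inv ≫ e ▷ X) ▷ X) ≫
        (α_ K X X).hom ≫ K ◁ b ≫ (α_ K X X).inv := by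
  rw [comp_whiskerRight]
  simp only [Category.assoc]
  rw [associator_naturality_left_assoc, ← whisker_exchange_assoc, associator_inv_naturality_left]
  monoidal

section Extend

variable [Preadditive C] [MonoidalPreadditive C]

/-- The ring homomorphism `f ↦ f ⊗ id` from the endomorphisms of `X^n` to those of
`X^N ≅ X^n ⊗ X^m`. -/
def extendRight (X : C) (n m N : ℕ) (h : n + m = N) :
    End (tensorPow X n) →+* End (tensorPow X N) where
  toFun f := (concatTo X n m N h).inv ≫ f ▷ tensorPow X m ≫ (concatTo X n m N h).hom
  map_one' := by
    change (concatTo X n m N h).inv ≫ (𝟙 _) ▷ tensorPow X m ≫ (concatTo X n m N h).hom = 𝟙 _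
    simp
  map_mul' f g := by
    change _ ≫ (g ≫ f) ▷ tensorPow X m ≫ _ = (_ ≫ _ ≫ _) ≫ (_ ≫ _ ≫ _)
    simp
  map_zero' := by simp
  map_add' f g := by
    have : ∀ {P Q K : C} (e : P ⊗ Q ≅ K) (f g : P ⟶ P), e.inv ≫ (f + g) ▷ Q ≫ e.hom =
        e.inv ≫ f ▷ Q ≫ e.hom + e.inv ≫ g ▷ Q ≫ e.hom := by
      simp [MonoidalPreadditive.add_whiskerRight]
    exact this _ f g

/-- The ring homomorphism `g ↦ id ⊗ g` from the endomorphisms of `X^m` to those of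
`X^N ≅ X^n ⊗ X^m`. -/
def extendLeft (X : C) (n m N : ℕ) (h : n + m = N) :
    End (tensorPow X m) →+* End (tensorPow X N) where
  toFun g := (concatTo X n m N h).inv ≫ tensorPow X n ◁ g ≫ (concatTo X n m N h).hom
  map_one' := by
    change (concatTo X n m N h).inv ≫ _ ◁ (𝟙 (tensorPow X m)) ≫ (concatTo X n m N h).hom = 𝟙 _
    simp
  map_mul' f g := by
    change _ ≫ tensorPow X n ◁ (g ≫ f) ≫ _ = (_ ≫ _ ≫ _) ≫ (_ ≫ _ ≫ _)
    simp
  map_zero' := by simp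
  map_add' f g := by
    have : ∀ {P Q K : C} (e : P ⊗ Q ≅ K) (f g : Q ⟶ Q), e.inv ≫ P ◁ (f + g) ≫ e.hom =
        e.inv ≫ P ◁ f ≫ e.hom + e.inv ≫ P ◁ g ≫ e.hom := by
      simp [MonoidalPreadditive.whiskerLeft_add]
    exact this _ f g

theorem extendRight_apply (X : C) (n m N : ℕ) (h : n + m = N) (f : End (tensorPow X n)) :
    extendRight X n m N h f =
      (concatTo X n m N h).inv ≫ f ▷ tensorPow X m ≫ (concatTo X n m N h).hom := rfl

theorem extendLeft_apply (X : C) (n m N : ℕ) (h : n + m = N) (g : End (tensorPow X m)) :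
    extendLeft X n m N h g =
      (concatTo X n m N h).inv ≫ tensorPow X n ◁ g ≫ (concatTo X n m N h).hom := rfl

theorem concatTo_comp_extendRight (X : C) (n m N : ℕ) (h : n + m = N) (f : End (tensorPow X n)) :
    (concatTo X n m N h).hom ≫ extendRight X n m N h f =
      f ▷ tensorPow X m ≫ (concatTo X n m N h).hom := by
  rw [extendRight_apply, Iso.hom_inv_id_assoc]

theorem concatTo_comp_extendLeft (X : C) (n m N : ℕ) (h : n + m = N) (g : End (tensorPow X m)) :
    (concatTo X n m N h).hom ≫ extendLeft X n m N h g =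
      tensorPow X n ◁ g ≫ (concatTo X n m N h).hom := by
  rw [extendLeft_apply, Iso.hom_inv_id_assoc]

theorem extendRight_succ (X : C) (n m N : ℕ) (h : n + m = N) (f : End (tensorPow X n)) :
    extendRight X n (m + 1) (N + 1) (by omega) f = extendRight X n m N h f ▷ X := by
  rw [extendRight_apply, extendRight_apply, concatTo_succ X n m N h]
  have : ∀ {P Q K : C} (e : P ⊗ K ≅ Q) (f : P ⟶ P),
      (e.inv ▷ X ≫ (α_ P K X).hom) ≫ f ▷ (K ⊗ X) ≫ (α_ P K X).inv ≫ e.hom ▷ X =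
        (e.inv ≫ f ▷ K ≫ e.hom) ▷ X := by
    intro P Q K e f
    simp
  exact this _ _

theorem extendLeft_succ (X : C) (n m N : ℕ) (h : n + m = N) (g : End (tensorPow X m)) :
    extendLeft X n (m + 1) (N + 1) (by omega) (show End (tensorPow X (m + 1)) from g ▷ X) =
      extendLeft X n m N h g ▷ X := by
  change (concatTo X n (m + 1) (N + 1) (by omega)).inv ≫ tensorPow X n ◁ (g ▷ X) ≫
    (concatTo X n (m + 1) (N + 1) (by omega)).hom = _
  rw [concatTo_succ X n m N h]
  have : ∀ {P Q K : C} (e : P ⊗ K ≅ Q) (g : K ⟶ K),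
      (e.inv ▷ X ≫ (α_ P K X).hom) ≫ P ◁ (g ▷ X) ≫ (α_ P K X).inv ≫ e.hom ▷ X =
        (e.inv ≫ P ◁ g ≫ e.hom) ▷ X := by
    intro P Q K e g
    simp
  exact this _ _

theorem extendRight_zero (X : C) (n : ℕ) (f : End (tensorPow X n)) :
    extendRight X n 0 n rfl f = f := by
  rw [extendRight_apply, concatTo_zero]
  exact (Iso.inv_comp_eq _).2 (rightUnitor_naturality f)

theorem extendRight_one (X : C) (n : ℕ) (f : End (tensorPow X n)) :
    extendRight X n 1 (n + 1) rfl f = f ▷ X := by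
  rw [extendRight_succ X n 0 n rfl, extendRight_zero]

variable [BraidedCategory C]

theorem extendRight_braidGen (X : C) (n m N a : ℕ) (h : n + m = N) (ha : a + 1 < n) :
    extendRight X n m N h (braidGen X n a) = braidGen X N a := by
  induction m generalizing N with
  | zero =>
    obtain rfl : n = N := h
    rw [extendRight_zero]
  | succ m ih =>
    obtain rfl : n + m + 1 = N := by omega
    rw [extendRight_succ X n m (n + m) rfl, ih (n + m) rfl, braidGen_succ X (by omega)]

theorem extendLeft_braidGen (X : C) (n m N a : ℕ) (h : n + m = N) (ha : a + 1 < m) :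
    extendLeft X n m N h (braidGen X m a) = braidGen X N (n + a) := by
  induction m generalizing N with
  | zero => omega
  | succ m ih =>
    by_cases ham : a + 1 < m
    · obtain rfl : n + m + 1 = N := by omega
      rw [braidGen_succ X ham, braidGen_succ X (show n + a + 1 < n + m by omega),
        ← ih (n + m) rfl ham]
      exact extendLeft_succ X n m (n + m) rfl (braidGen X m a)
    · obtain rfl : m = a + 1 := by omega
      obtain rfl : n + a + 2 = N := by omega
      rw [braidGen_last, braidGen_last, extendLeft_apply, concatTo_succ X n (a + 1) (n + a + 1) rfl,
        concatTo_succ X n a (n + a) rfl]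
      exact (Iso.inv_comp_eq _).2
        (whiskerLeft_braid_comp (concatTo X n a (n + a) rfl).hom (β_ X X).hom)

end Extend

end StrandAlgebra

section StrandScalars

variable {C : Type u} [Category.{v} C] [MonoidalCategory C] [Preadditive C] [MonoidalPreadditive C]

theorem extendRight_scalarEnd (lam : Aut (𝟙_ C)) (X : C) (n m N : ℕ) (h : n + m = N) :
    extendRight X n m N h (scalarEnd lam _) = scalarEnd lam _ := by
  rw [extendRight_apply, scalarEnd, scalar_whiskerRight]
  exact (Iso.inv_comp_eq _).2 (scalar_naturality lam _)

end StrandScalars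

/-! ### The ring elements of the braided binomials and of the antipode -/

section StrandGenerators

variable {C : Type u} [Category.{v} C] [MonoidalCategory C] [BraidedCategory C] [Preadditive C]

/-- The braidings of neighbouring factors of `X^N`, as a sequence in the endomorphism ring. The
entries beyond the last pair of factors are zero, which keeps the braid relations valid. -/
def braidSeq (X : C) (N : ℕ) (a : ℕ) : End (tensorPow X N) :=
  if a + 1 < N then braidGen X N a else 0

/-- The braidings of neighbouring factors of `X^N`, multiplied by the scalar `lam`. -/
def twistedSeq (lam : Aut (𝟙_ C)) (X : C) (N : ℕ) (a : ℕ) : End (tensorPow X N) :=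
  scalarEnd lam _ * braidSeq X N a

theorem braidSeq_of_lt (X : C) {N a : ℕ} (h : a + 1 < N) : braidSeq X N a = braidGen X N a :=
  if_pos h

theorem isBraidSeq_braidSeq (X : C) (N : ℕ) : IsBraidSeq (braidSeq X N) where
  comm a b h := by
    by_cases hb : b + 1 < N
    · rw [braidSeq_of_lt X hb, braidSeq_of_lt X (show a + 1 < N by omega)]
      exact (braidGen_comm X h hb).symm
    · rw [show braidSeq X N b = 0 from if_neg hb]
      exact Commute.zero_right _
  braid a := by
    by_cases ha : a + 2 < N
    · rw [braidSeq_of_lt X (show a + 1 < N by omega), braidSeq_of_lt X (show a + 1 + 1 < N from ha)]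
      exact braidGen_braid X ha
    · rw [show braidSeq X N (a + 1) = 0 from if_neg ha]
      simp only [mul_zero, zero_mul]

theorem isBraidSeq_twistedSeq (lam : Aut (𝟙_ C)) (X : C) (N : ℕ) :
    IsBraidSeq (twistedSeq lam X N) :=
  (isBraidSeq_braidSeq X N).central_mul (commute_scalarEnd lam)

theorem braidWord_eq_prod (X : C) {N : ℕ} (w : List (Fin (N - 1))) :
    braidWord X w = (w.map fun a : Fin (N - 1) => braidSeq X N a).prod := by
  induction w with
  | nil => rfl
  | cons a w ih =>
    have ha := a.2
    rw [List.map_cons, List.prod_cons, ← ih, braidSeq_of_lt X (by omega)]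
    rfl

theorem scalar_comp_braidLift (lam : Aut (𝟙_ C)) (X : C) {N : ℕ} (σ : Equiv.Perm (Fin N)) :
    (scalar (lam ^ permLength σ) _).hom ≫ braidLift X σ = permLift (twistedSeq lam X N) σ := by
  rw [braidLift, braidWord_eq_prod, scalar_pow_hom,
    ← (isBraidSeq_twistedSeq lam X N).prod_map_reducedWord]
  have := prod_map_central_mul (commute_scalarEnd lam)
    (fun a : Fin (N - 1) => braidSeq X N a) (reducedWord σ)
  exact ((commute_scalarEnd lam _).pow_left _).symm.eq.trans this.symm

theorem braidedBinomial_eq_shuf (lam : Aut (𝟙_ C)) (X : C) (n m : ℕ) :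
    braidedBinomial lam X n m = shuf (twistedSeq lam X (n + m)) 0 n m := by
  rw [← sum_permLift_shuffles]
  exact Finset.sum_congr rfl fun σ _ => scalar_comp_braidLift lam X σ

theorem dualBraidedBinomial_eq_dualShuf (lam : Aut (𝟙_ C)) (X : C) (n m : ℕ) :
    dualBraidedBinomial lam X n m = dualShuf (twistedSeq lam X (n + m)) 0 n m := by
  rw [← sum_permLift_inverseShuffles (isBraidSeq_twistedSeq lam X (n + m))]
  exact Finset.sum_congr rfl fun σ _ => scalar_comp_braidLift lam X σ

theorem tensorAntipode_eq_halfTwist (lam : Aut (𝟙_ C)) (X : C) (n : ℕ) :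
    tensorAntipode lam X n =
      ((-1) ^ n * halfTwist (twistedSeq lam X n) 0 n : End (tensorPow X n)) := by
  have h1 : braidLift X (Fin.revPerm : Equiv.Perm (Fin n)) = halfTwist (braidSeq X n) 0 n := by
    rw [← permLift_revPerm, ← (isBraidSeq_braidSeq X n).prod_map_reducedWord, braidLift,
      braidWord_eq_prod]
  have h2 : halfTwist (twistedSeq lam X n) 0 n =
      scalarEnd lam _ ^ n.choose 2 * halfTwist (braidSeq X n) 0 n :=
    halfTwist_central_mul (commute_scalarEnd lam) _ _ _
  have h3 : ((scalar (lam ^ n.choose 2) _).hom ≫ braidLift X (Fin.revPerm : Equiv.Perm (Fin n))) =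
      halfTwist (twistedSeq lam X n) 0 n := by
    rw [h1, h2, scalar_pow_hom]
    exact ((commute_scalarEnd lam _).pow_left _).symm.eq
  rw [tensorAntipode, h3]
  rcases Nat.even_or_odd n with hn | hn
  · rw [hn.neg_one_pow, hn.neg_one_pow, one_smul, one_mul]
  · rw [hn.neg_one_pow, hn.neg_one_pow, neg_smul, one_smul, neg_one_mul]

variable [MonoidalPreadditive C]

theorem extendLeft_scalarEnd (lam : Aut (𝟙_ C)) (X : C) (n m N : ℕ) (h : n + m = N) :
    extendLeft X n m N h (scalarEnd lam _) = scalarEnd lam _ := by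
  rw [extendLeft_apply, scalarEnd, whiskerLeft_scalar]
  exact (Iso.inv_comp_eq _).2 (scalar_naturality lam _)

theorem extendRight_twistedSeq (lam : Aut (𝟙_ C)) (X : C) {n m N a : ℕ} (h : n + m = N)
    (ha : a + 1 < n) :
    extendRight X n m N h (twistedSeq lam X n a) = twistedSeq lam X N a := by
  rw [twistedSeq, twistedSeq, map_mul, extendRight_scalarEnd, braidSeq_of_lt X ha,
    braidSeq_of_lt X (by omega), extendRight_braidGen X n m N a h ha]

theorem extendLeft_twistedSeq (lam : Aut (𝟙_ C)) (X : C) {n m N a : ℕ} (h : n + m = N)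
    (ha : a + 1 < m) :
    extendLeft X n m N h (twistedSeq lam X m a) = twistedSeq lam X N (n + a) := by
  rw [twistedSeq, twistedSeq, map_mul, extendLeft_scalarEnd, braidSeq_of_lt X ha,
    braidSeq_of_lt X (by omega), extendLeft_braidGen X n m N a h ha]

theorem extendRight_halfTwist (lam : Aut (𝟙_ C)) (X : C) {n m N : ℕ} (h : n + m = N) :
    extendRight X n m N h (halfTwist (twistedSeq lam X n) 0 n) =
      halfTwist (twistedSeq lam X N) 0 n := by
  rw [map_halfTwist]
  exact halfTwist_congr fun b hb => extendRight_twistedSeq lam X h (by omega)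

theorem extendLeft_halfTwist (lam : Aut (𝟙_ C)) (X : C) {n m N : ℕ} (h : n + m = N) :
    extendLeft X n m N h (halfTwist (twistedSeq lam X m) 0 m) =
      halfTwist (twistedSeq lam X N) n m := by
  rw [map_halfTwist]
  refine halfTwist_congr fun b hb => ?_
  rw [zero_add]
  exact extendLeft_twistedSeq lam X h (by omega)

theorem extendRight_shuf (lam : Aut (𝟙_ C)) (X : C) {n m N i j : ℕ} (h : n + m = N)
    (hij : i + j = n) : extendRight X n m N h (shuf (twistedSeq lam X n) 0 i j) =
      shuf (twistedSeq lam X N) 0 i j := by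
  rw [map_shuf]
  exact shuf_congr fun b hb => extendRight_twistedSeq lam X h (by omega)

theorem extendLeft_shuf (lam : Aut (𝟙_ C)) (X : C) {n m N i j : ℕ} (h : n + m = N)
    (hij : i + j = m) : extendLeft X n m N h (shuf (twistedSeq lam X m) 0 i j) =
      shuf (twistedSeq lam X N) n i j := by
  rw [map_shuf]
  refine shuf_congr fun b hb => ?_
  rw [zero_add]
  exact extendLeft_twistedSeq lam X h (by omega)

theorem extendRight_dualShuf (lam : Aut (𝟙_ C)) (X : C) {n m N i j : ℕ} (h : n + m = N)
    (hij : i + j = n) : extendRight X n m N h (dualShuf (twistedSeq lam X n) 0 i j) =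
      dualShuf (twistedSeq lam X N) 0 i j := by
  rw [map_dualShuf]
  exact dualShuf_congr fun b hb => extendRight_twistedSeq lam X h (by omega)

theorem extendLeft_dualShuf (lam : Aut (𝟙_ C)) (X : C) {n m N i j : ℕ} (h : n + m = N)
    (hij : i + j = m) : extendLeft X n m N h (dualShuf (twistedSeq lam X m) 0 i j) =
      dualShuf (twistedSeq lam X N) n i j := by
  rw [map_dualShuf]
  refine dualShuf_congr fun b hb => ?_
  rw [zero_add]
  exact extendLeft_twistedSeq lam X h (by omega)

end StrandGenerators

/-! ### The braiding of tensor powers as an exchange of blocks -/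

section BlockBraiding

variable {C : Type u} [Category.{v} C] [MonoidalCategory C] [BraidedCategory C]

/-- The induction step for `braiding_comp_concatTo`: the hexagon identity for the braiding of `J`
with `K ⊗ X`, with arbitrary morphisms in place of the canonical isomorphisms. -/
theorem braiding_tensor_step {J K X L : C} {c₁ : K ⊗ J ⟶ L} {c₂ : J ⊗ K ⟶ L} {b : L ⟶ L}
    (h₁ : (β_ J K).hom ≫ c₁ = c₂ ≫ b) {d : X ⊗ J ⟶ J ⊗ X} {t : J ⊗ X ⟶ J ⊗ X}
    (h₂ : (β_ J X).hom ≫ d = t) {e : L ⊗ X ⟶ L ⊗ X}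
    (h₃ : ((α_ K J X).inv ≫ c₁ ▷ X) ≫ e = K ◁ t ≫ (α_ K J X).inv ≫ c₁ ▷ X) :
    (β_ J (K ⊗ X)).hom ≫ (α_ K X J).hom ≫ K ◁ d ≫ (α_ K J X).inv ≫ c₁ ▷ X =
      ((α_ J K X).inv ≫ c₂ ▷ X) ≫ b ▷ X ≫ e := by
  have h₄ := congrArg (· ▷ X) h₁
  simp only [comp_whiskerRight] at h₄
  subst h₂
  rw [BraidedCategory.braiding_tensor_right_hom]
  simp only [Category.assoc, Iso.inv_hom_id_assoc, whiskerLeft_comp] at h₃ ⊢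
  rw [← h₃, Iso.hom_inv_id_assoc, reassoc_of% h₄]

variable [Preadditive C] [MonoidalPreadditive C]

theorem ascProd_braidSeq_succ (X : C) (n : ℕ) : ascProd (braidSeq X (n + 2)) 0 (n + 1) =
    braidLast X n ≫ (show tensorPow X (n + 2) ⟶ tensorPow X (n + 2) from
      (show tensorPow X (n + 1) ⟶ tensorPow X (n + 1) from
        (ascProd (braidSeq X (n + 1)) 0 n : End (tensorPow X (n + 1)))) ▷ X) := by
  have h : ascProd (braidSeq X (n + 2)) 0 n =
      extendRight X (n + 1) 1 (n + 2) rfl (ascProd (braidSeq X (n + 1)) 0 n) := by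
    rw [map_ascProd]
    refine ascProd_congr fun b hb => ?_
    rw [zero_add, braidSeq_of_lt X (show b + 1 < n + 1 by omega),
      braidSeq_of_lt X (show b + 1 < n + 2 by omega),
      extendRight_braidGen X (n + 1) 1 (n + 2) b rfl (by omega)]
  rw [ascProd, h, extendRight_one, zero_add, braidSeq_of_lt X (by omega), braidGen_last]
  rfl

/-- The braiding of `X^n` with `X` moves the last factor to the front. -/
theorem braiding_comp_consHom (X : C) (n : ℕ) :
    (β_ (tensorPow X n) X).hom ≫ consHom X n = ascProd (braidSeq X (n + 1)) 0 n := by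
  induction n with
  | zero =>
    change (β_ (𝟙_ C) X).hom ≫ (λ_ X).inv ▷ 𝟙_ C ≫ (concatTo X 1 0 1 rfl).hom = 𝟙 _
    rw [concatTo_zero, braiding_tensorUnit_left]
    change ((λ_ X).hom ≫ (ρ_ X).inv) ≫ (λ_ X).inv ▷ 𝟙_ C ≫ (ρ_ (𝟙_ C ⊗ X)).hom = 𝟙 (𝟙_ C ⊗ X)
    simp
  | succ n ih =>
    rw [ascProd_braidSeq_succ, ← ih, consHom_succ]
    have : ∀ {P K : C} (c : X ⊗ P ⟶ K), (β_ (P ⊗ X) X).hom ≫ (α_ X P X).inv ≫ c ▷ X =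
        ((α_ P X X).hom ≫ P ◁ (β_ X X).hom ≫ (α_ P X X).inv) ≫ ((β_ P X).hom ≫ c) ▷ X := by
      intro P K c
      rw [BraidedCategory.braiding_tensor_left_hom]
      simp
    exact this _

/-- The braiding of `X^j` with `X^k` exchanges the two blocks of factors. -/
theorem braiding_comp_concatTo (X : C) (j k N : ℕ) (h : j + k = N) :
    (β_ (tensorPow X j) (tensorPow X k)).hom ≫ (concatTo X k j N (by omega)).hom =
      (concatTo X j k N h).hom ≫ (blockBraid (braidSeq X N) 0 j k : End (tensorPow X N)) := by
  induction k generalizing N with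
  | zero =>
    obtain rfl : j = N := h
    change (β_ (tensorPow X j) (𝟙_ C)).hom ≫ (concatTo X 0 j j _).hom =
      (concatTo X j 0 j rfl).hom ≫ 𝟙 _
    rw [concatTo_zero_left, concatTo_zero, braiding_tensorUnit_right, Category.comp_id]
    exact (Category.assoc _ _ _).trans ((congrArg _ (Iso.inv_hom_id _)).trans (Category.comp_id _))
  | succ k ih =>
    obtain rfl : j + k + 1 = N := by omega
    have h₃ := concatTo_comp_extendLeft X k (j + 1) (j + k + 1) (by omega)
      (ascProd (braidSeq X (j + 1)) 0 j)
    have h₄ : extendLeft X k (j + 1) (j + k + 1) (by omega) (ascProd (braidSeq X (j + 1)) 0 j) =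
        ascProd (braidSeq X (j + k + 1)) k j := by
      rw [map_ascProd]
      refine ascProd_congr fun b hb => ?_
      rw [zero_add, braidSeq_of_lt X (show b + 1 < j + 1 by omega),
        braidSeq_of_lt X (show k + b + 1 < j + k + 1 by omega),
        extendLeft_braidGen X k (j + 1) (j + k + 1) b (by omega) (by omega)]
    have h₅ : blockBraid (braidSeq X (j + k + 1)) 0 j k =
        extendRight X (j + k) 1 (j + k + 1) rfl (blockBraid (braidSeq X (j + k)) 0 j k) := by
      rw [map_blockBraid]
      refine blockBraid_congr fun b hb => ?_
      rw [zero_add, braidSeq_of_lt X (show b + 1 < j + k by omega),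
        braidSeq_of_lt X (show b + 1 < j + k + 1 by omega),
        extendRight_braidGen X (j + k) 1 (j + k + 1) b rfl (by omega)]
    rw [h₄, concatTo_succ_hom X k j (j + k) (by omega)] at h₃
    rw [concatTo_succ_left X k j (j + k + 1) (by omega), concatTo_succ_hom X k j (j + k) (by omega),
      concatTo_succ_hom X j k (j + k) rfl, blockBraid, h₅, extendRight_one, zero_add]
    exact braiding_tensor_step (ih (j + k) rfl) (braiding_comp_consHom X j) h₃

/-- On a tensor product of four powers of `X`, the exchange of the two middle factors, scaled by
`lam ^ (j * k)`, is the exchange of blocks of strands. -/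
theorem tensorμ_comp_concatTo (lam : Aut (𝟙_ C)) (X : C) (i j k l n m p q N : ℕ)
    (hn : i + j = n) (hm : k + l = m) (hp : i + k = p) (hq : j + l = q) (hN : n + m = N)
    (hN' : p + q = N) :
    (scalar (lam ^ (j * k)) _).hom ≫
        tensorμ (tensorPow X i) (tensorPow X j) (tensorPow X k) (tensorPow X l) ≫
          ((concatTo X i k p hp).hom ⊗ₘ (concatTo X j l q hq).hom) ≫ (concatTo X p q N hN').hom =
      ((concatTo X i j n hn).hom ⊗ₘ (concatTo X k l m hm).hom) ≫ (concatTo X n m N hN).hom ≫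
        (blockBraid (twistedSeq lam X N) i j k : End (tensorPow X N)) := by
  have h1 : blockBraid (twistedSeq lam X N) i j k =
      (scalarEnd lam _) ^ (j * k) * blockBraid (braidSeq X N) i j k :=
    blockBraid_central_mul (commute_scalarEnd lam) _ _ _ _
  have h2 : blockBraid (braidSeq X N) i j k = extendLeft X i (j + k + l) N (by omega)
      (extendRight X (j + k) l (j + k + l) rfl (blockBraid (braidSeq X (j + k)) 0 j k)) := by
    rw [map_blockBraid, map_blockBraid]
    refine (blockBraid_congr fun b hb => ?_).symm
    rw [zero_add, braidSeq_of_lt X (show b + 1 < j + k from hb),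
      extendRight_braidGen X (j + k) l (j + k + l) b rfl hb,
      extendLeft_braidGen X i (j + k + l) N b (by omega) (by omega),
      braidSeq_of_lt X (by omega)]
  have h3 : tensorμ (tensorPow X i) (tensorPow X j) (tensorPow X k) (tensorPow X l) ≫
      ((concatTo X i k p hp).hom ⊗ₘ (concatTo X j l q hq).hom) ≫ (concatTo X p q N hN').hom =
      ((concatTo X i j n hn).hom ⊗ₘ (concatTo X k l m hm).hom) ≫ (concatTo X n m N hN).hom ≫
        (blockBraid (braidSeq X N) i j k : End (tensorPow X N)) := by
    rw [← Category.assoc (_ ⊗ₘ _),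
      concatTo_tensor X i j k l n m (j + k) (j + k + l) N hn hm rfl rfl hN (by omega),
      concatTo_tensor X i k j l p q (j + k) (j + k + l) N hp hq (by omega) rfl hN' (by omega), h2]
    simp only [Category.assoc]
    rw [concatTo_comp_extendLeft, ← whiskerLeft_comp_assoc]
    simp only [Category.assoc]
    rw [concatTo_comp_extendRight, ← comp_whiskerRight_assoc, ← braiding_comp_concatTo X j k _ rfl]
    simp [tensorμ]
  rw [h3, h1, scalar_naturality_assoc, scalar_naturality_assoc, scalar_pow_hom]
  congr 2
  exact ((commute_scalarEnd lam _).pow_left _).symm.eq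

end BlockBraiding

/-! ### Tensor products of graded objects on homogeneous summands -/

section GradedSummands

open GradedObject.Monoidal (ιTensorObj tensorObjDesc ι_tensorObjDesc)

variable {C : Type u} [Category.{v} C] [Abelian C] [MonoidalCategory C] [MonoidalPreadditive C]
  [BraidedCategory C]

/-- The inclusion of the summand `Y i ⊗ Z j` into the degree `n` part of `Y ⊗ Z` if `i + j = n`,
and zero otherwise. -/
noncomputable def tensorι (Y Z : GradedObject ℕ C) (i j n : ℕ) :
    Y i ⊗ Z j ⟶ (Y ⊗ Z : GradedObject ℕ C) n :=
  if h : i + j = n then ιTensorObj Y Z i j n h else 0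

theorem tensorι_of_eq (Y Z : GradedObject ℕ C) {i j n : ℕ} (h : i + j = n) :
    tensorι Y Z i j n = ιTensorObj Y Z i j n h := dif_pos h

theorem tensorι_hom_ext {Y Z : GradedObject ℕ C} {n : ℕ} {A : C}
    {f g : (Y ⊗ Z : GradedObject ℕ C) n ⟶ A}
    (h : ∀ i j, i + j = n → tensorι Y Z i j n ≫ f = tensorι Y Z i j n ≫ g) : f = g := by
  apply GradedObject.Monoidal.tensorObj_ext
  intro i j hij
  have := h i j hij
  rwa [tensorι_of_eq Y Z hij] at this

theorem tensorι_hom_ext₃ {Y Z W : GradedObject ℕ C} {n : ℕ} {A : C}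
    {f g : ((Y ⊗ Z) ⊗ W : GradedObject ℕ C) n ⟶ A}
    (h : ∀ i j k, i + j + k = n →
      tensorι Y Z i j (i + j) ▷ W k ≫ tensorι (Y ⊗ Z) W (i + j) k n ≫ f =
        tensorι Y Z i j (i + j) ▷ W k ≫ tensorι (Y ⊗ Z) W (i + j) k n ≫ g) : f = g := by
  apply GradedObject.Monoidal.tensorObj₃'_ext
  intro i j k hijk
  have := h i j k hijk
  rw [tensorι_of_eq Y Z rfl, tensorι_of_eq (Y ⊗ Z) W hijk] at this
  rw [GradedObject.Monoidal.ιTensorObj₃'_eq Y Z W i j k n hijk _ rfl, Category.assoc,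
    Category.assoc]
  exact this

/-- The morphism out of the degree `n` part of `Y ⊗ Z` with given restrictions to the summands. -/
noncomputable def tensorDesc {Y Z : GradedObject ℕ C} {n : ℕ} {A : C}
    (f : ∀ i j, Y i ⊗ Z j ⟶ A) : (Y ⊗ Z : GradedObject ℕ C) n ⟶ A :=
  tensorObjDesc fun i j _ => f i j

theorem tensorι_desc {Y Z : GradedObject ℕ C} {n : ℕ} {A : C} (f : ∀ i j, Y i ⊗ Z j ⟶ A)
    {i j : ℕ} (h : i + j = n) : tensorι Y Z i j n ≫ tensorDesc f = f i j := by
  rw [tensorι_of_eq Y Z h]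
  exact ι_tensorObjDesc _ _ _ _

theorem tensorι_tensorHom {Y Z Y' Z' : GradedObject ℕ C} (f : Y ⟶ Y') (g : Z ⟶ Z') (i j n : ℕ) :
    tensorι Y Z i j n ≫ (f ⊗ₘ g) n = (f i ⊗ₘ g j) ≫ tensorι Y' Z' i j n := by
  by_cases h : i + j = n
  · rw [tensorι_of_eq Y Z h, tensorι_of_eq Y' Z' h]
    exact GradedObject.Monoidal.ι_tensorHom f g i j n h
  · rw [tensorι, tensorι, dif_neg h, dif_neg h, zero_comp, comp_zero]

theorem tensorι_whiskerRight {Y Y' : GradedObject ℕ C} (f : Y ⟶ Y') (Z : GradedObject ℕ C)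
    (i j n : ℕ) : tensorι Y Z i j n ≫ (f ▷ Z) n = f i ▷ Z j ≫ tensorι Y' Z i j n := by
  rw [← MonoidalCategory.tensorHom_id, tensorι_tensorHom, ← MonoidalCategory.tensorHom_id]
  rfl

theorem tensorι_whiskerLeft (Y : GradedObject ℕ C) {Z Z' : GradedObject ℕ C} (g : Z ⟶ Z')
    (i j n : ℕ) : tensorι Y Z i j n ≫ (Y ◁ g) n = Y i ◁ g j ≫ tensorι Y Z' i j n := by
  rw [← MonoidalCategory.id_tensorHom, tensorι_tensorHom, ← MonoidalCategory.id_tensorHom]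
  rfl

theorem tensorι_whiskerRight_assoc {Y Y' : GradedObject ℕ C} (f : Y ⟶ Y') (Z : GradedObject ℕ C)
    (i j n : ℕ) {A : C} (g : (Y' ⊗ Z : GradedObject ℕ C) n ⟶ A) :
    tensorι Y Z i j n ≫ (f ▷ Z) n ≫ g = f i ▷ Z j ≫ tensorι Y' Z i j n ≫ g := by
  rw [← Category.assoc, tensorι_whiskerRight, Category.assoc]

theorem tensorι_whiskerLeft_assoc (Y : GradedObject ℕ C) {Z Z' : GradedObject ℕ C} (f : Z ⟶ Z')
    (i j n : ℕ) {A : C} (g : (Y ⊗ Z' : GradedObject ℕ C) n ⟶ A) :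
    tensorι Y Z i j n ≫ (Y ◁ f) n ≫ g = Y i ◁ f j ≫ tensorι Y Z' i j n ≫ g := by
  rw [← Category.assoc, tensorι_whiskerLeft, Category.assoc]

theorem tensorι_associator_hom (Y Z W : GradedObject ℕ C) {i j k n m N : ℕ} (hn : i + j = n)
    (hm : j + k = m) (hN : i + j + k = N) :
    tensorι Y Z i j n ▷ W k ≫ tensorι (Y ⊗ Z) W n k N ≫ (α_ Y Z W).hom N =
      (α_ (Y i) (Z j) (W k)).hom ≫ Y i ◁ tensorι Z W j k m ≫ tensorι Y (Z ⊗ W) i m N := by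
  have h := GradedObject.Monoidal.ιTensorObj₃'_associator_hom Y Z W i j k N hN
  rw [GradedObject.Monoidal.ιTensorObj₃'_eq Y Z W i j k N hN n hn,
    GradedObject.Monoidal.ιTensorObj₃_eq Y Z W i j k N hN m hm, Category.assoc] at h
  rw [tensorι_of_eq Y Z hn, tensorι_of_eq (Y ⊗ Z) W (show n + k = N by omega),
    tensorι_of_eq Z W hm, tensorι_of_eq Y (Z ⊗ W) (show i + m = N by omega)]
  exact h

theorem tensorι_associator_inv (Y Z W : GradedObject ℕ C) {i j k n m N : ℕ} (hn : i + j = n)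
    (hm : j + k = m) (hN : i + j + k = N) :
    Y i ◁ tensorι Z W j k m ≫ tensorι Y (Z ⊗ W) i m N ≫ (α_ Y Z W).inv N =
      (α_ (Y i) (Z j) (W k)).inv ≫ tensorι Y Z i j n ▷ W k ≫ tensorι (Y ⊗ Z) W n k N := by
  have h := GradedObject.Monoidal.ιTensorObj₃_associator_inv Y Z W i j k N hN
  rw [GradedObject.Monoidal.ιTensorObj₃'_eq Y Z W i j k N hN n hn,
    GradedObject.Monoidal.ιTensorObj₃_eq Y Z W i j k N hN m hm, Category.assoc] at h
  rw [tensorι_of_eq Y Z hn, tensorι_of_eq (Y ⊗ Z) W (show n + k = N by omega),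
    tensorι_of_eq Z W hm, tensorι_of_eq Y (Z ⊗ W) (show i + m = N by omega)]
  exact h

theorem leftUnitor_inv_degree (Y : GradedObject ℕ C) (n : ℕ) :
    (λ_ Y).inv n = (λ_ (Y n)).inv ≫ (unitZero (C := C)).inv ▷ Y n ≫
      tensorι (𝟙_ (GradedObject ℕ C)) Y 0 n n := by
  rw [tensorι_of_eq _ Y (zero_add n)]
  exact GradedObject.Monoidal.leftUnitor_inv_apply Y n

theorem rightUnitor_inv_degree (Y : GradedObject ℕ C) (n : ℕ) :
    (ρ_ Y).inv n = (ρ_ (Y n)).inv ≫ Y n ◁ (unitZero (C := C)).inv ≫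
      tensorι Y (𝟙_ (GradedObject ℕ C)) n 0 n := by
  rw [tensorι_of_eq Y _ (add_zero n)]
  exact GradedObject.Monoidal.rightUnitor_inv_apply Y n

theorem tensorι_braiding (lam : Aut (𝟙_ C)) (Y Z : GradedObject ℕ C) (i j n : ℕ) :
    tensorι Y Z i j n ≫ gradedBraidingHom lam Y Z n =
      (scalar (lam ^ (i * j)) _).hom ≫ (β_ (Y i) (Z j)).hom ≫ tensorι Z Y j i n := by
  by_cases h : i + j = n
  · rw [tensorι_of_eq Y Z h, tensorι_of_eq Z Y (show j + i = n by omega)]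
    exact ι_gradedBraidingHom lam Y Z i j n h
  · rw [tensorι, tensorι, dif_neg h, dif_neg (by omega), zero_comp, comp_zero, comp_zero]

/-- The exchange of the two middle factors in a tensor product of four graded objects, for the
`lam`-braiding. -/
noncomputable def gradedTensorμ (lam : Aut (𝟙_ C)) (Y Y' Z Z' : GradedObject ℕ C) :
    (Y ⊗ Y') ⊗ (Z ⊗ Z') ⟶ (Y ⊗ Z) ⊗ (Y' ⊗ Z') :=
  @tensorμ (GradedObject ℕ C) _ _ (gradedBraided lam) Y Y' Z Z'

/-- On homogeneous summands, the exchange of the two middle factors is the one of `C`, scaled by the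
power of `lam` that belongs to the two degrees exchanged. -/
theorem tensorι_gradedTensorμ (lam : Aut (𝟙_ C)) (Y Y' Z Z' : GradedObject ℕ C)
    {i j k l n m p q N : ℕ} (hn : i + j = n) (hm : k + l = m) (hp : i + k = p) (hq : j + l = q)
    (hN : n + m = N) :
    (tensorι Y Y' i j n ⊗ₘ tensorι Z Z' k l m) ≫ tensorι (Y ⊗ Y') (Z ⊗ Z') n m N ≫
        gradedTensorμ lam Y Y' Z Z' N =
      (scalar (lam ^ (j * k)) _).hom ≫ tensorμ (Y i) (Y' j) (Z k) (Z' l) ≫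
        (tensorι Y Z i k p ⊗ₘ tensorι Y' Z' j l q) ≫ tensorι (Y ⊗ Z) (Y' ⊗ Z') p q N := by
  have e : gradedTensorμ lam Y Y' Z Z' N = (α_ Y Y' (Z ⊗ Z')).hom N ≫ (Y ◁ (α_ Y' Z Z').inv) N ≫
      (Y ◁ ((show Y' ⊗ Z ⟶ Z ⊗ Y' from gradedBraidingHom lam Y' Z) ▷ Z')) N ≫
        (Y ◁ (α_ Z Y' Z').hom) N ≫ (α_ Y Z (Y' ⊗ Z')).inv N := rfl
  have h1 := tensorι_associator_hom Y Y' (Z ⊗ Z') hn (show j + m = j + k + l by omega)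
    (show i + j + m = N by omega)
  have h2 := tensorι_associator_inv Y' Z Z' (rfl : j + k = j + k) hm (rfl : j + k + l = j + k + l)
  have h3 := tensorι_associator_hom Z Y' Z' (show k + j = j + k by omega) hq
    (show k + j + l = j + k + l by omega)
  have h4 := tensorι_associator_inv Y Z (Y' ⊗ Z') hp (show k + q = j + k + l by omega)
    (show i + k + q = N by omega)
  have hmid : Y' j ◁ tensorι Z Z' k l m ≫ tensorι Y' (Z ⊗ Z') j m (j + k + l) ≫
      (α_ Y' Z Z').inv (j + k + l) ≫
        ((show Y' ⊗ Z ⟶ Z ⊗ Y' from gradedBraidingHom lam Y' Z) ▷ Z') (j + k + l) ≫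
          (α_ Z Y' Z').hom (j + k + l) =
      (α_ (Y' j) (Z k) (Z' l)).inv ≫ (scalar (lam ^ (j * k)) _).hom ▷ Z' l ≫
        (β_ (Y' j) (Z k)).hom ▷ Z' l ≫ (α_ (Z k) (Y' j) (Z' l)).hom ≫
          Z k ◁ tensorι Y' Z' j l q ≫ tensorι Z (Y' ⊗ Z') k q (j + k + l) := by
    have h5 := congrArg (· ▷ Z' l) (tensorι_braiding lam Y' Z j k (j + k))
    simp only [comp_whiskerRight] at h5
    rw [reassoc_of% h2, tensorι_whiskerRight_assoc, reassoc_of% h5, h3]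
  rw [e, MonoidalCategory.tensorHom_def', Category.assoc, reassoc_of% h1,
    associator_naturality_right_assoc, tensorι_whiskerLeft_assoc, tensorι_whiskerLeft_assoc,
    tensorι_whiskerLeft_assoc]
  simp only [← whiskerLeft_comp_assoc]
  rw [hmid]
  simp only [whiskerLeft_comp, Category.assoc]
  rw [h4, tensorμ, MonoidalCategory.tensorHom_def', Category.assoc,
    associator_inv_naturality_right_assoc,
    scalar_whiskerRight, whiskerLeft_scalar]
  simp only [Category.assoc, scalar_naturality]

end GradedSummands

/-! ### Graded Hopf algebras from their homogeneous components -/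

section GradedHopfComponents

open Finset

/-- Two ways to sum over the decompositions of `N` into three summands. -/
theorem sum_antidiagonal_assoc {A : Type*} [AddCommMonoid A] (f : ℕ → ℕ → ℕ → A) (N : ℕ) :
    ∑ x ∈ antidiagonal N, ∑ y ∈ antidiagonal x.2, f x.1 y.1 y.2 =
      ∑ x ∈ antidiagonal N, ∑ y ∈ antidiagonal x.1, f y.1 y.2 x.2 := by
  rw [sum_sigma', sum_sigma']
  refine sum_bij' (fun z _ => ⟨(z.1.1 + z.2.1, z.2.2), (z.1.1, z.2.1)⟩)
    (fun z _ => ⟨(z.2.1, z.2.2 + z.1.2), (z.2.2, z.1.2)⟩) ?_ ?_ ?_ ?_ ?_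
  all_goals
    rintro ⟨⟨a, b⟩, c, d⟩ h
    simp only [mem_sigma, HasAntidiagonal.mem_antidiagonal] at h ⊢
  · rw [and_true]
    omega
  · rw [and_true]
    omega
  · obtain ⟨-, rfl⟩ := h
    rfl
  · obtain ⟨-, rfl⟩ := h
    rfl

variable {C : Type u} [Category.{v} C] [Abelian C] [MonoidalCategory C] [BraidedCategory C]

/-- The data of a Hopf algebra on a graded object whose degree zero part is the unit object, in
components. The components `mul i j n` and `comul i j n` matter for `i + j = n` only. The unit and
the counit are the identification `unit` in degree zero. -/
structure GradedHopfComponents (lam : Aut (𝟙_ C)) (T : GradedObject ℕ C) where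
  /-- The identification of the degree zero part with the unit object. -/
  unit : 𝟙_ C ≅ T 0
  /-- The components of the product. -/
  mul : ∀ i j n, T i ⊗ T j ⟶ T n
  /-- The components of the coproduct. -/
  comul : ∀ i j n, T n ⟶ T i ⊗ T j
  /-- The components of the antipode. -/
  antipode : ∀ n, T n ⟶ T n
  one_mul : ∀ n, unit.hom ▷ T n ≫ mul 0 n n = (λ_ (T n)).hom
  mul_one : ∀ n, T n ◁ unit.hom ≫ mul n 0 n = (ρ_ (T n)).hom
  mul_assoc : ∀ i j k N, i + j + k = N → mul i j (i + j) ▷ T k ≫ mul (i + j) k N =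
    (α_ _ _ _).hom ≫ T i ◁ mul j k (j + k) ≫ mul i (j + k) N
  counit_comul : ∀ n, comul 0 n n ≫ unit.inv ▷ T n = (λ_ (T n)).inv
  comul_counit : ∀ n, comul n 0 n ≫ T n ◁ unit.inv = (ρ_ (T n)).inv
  comul_assoc : ∀ i j k N, i + j + k = N → comul i (j + k) N ≫ T i ◁ comul j k (j + k) =
    comul (i + j) k N ≫ comul i j (i + j) ▷ T k ≫ (α_ _ _ _).hom
  mul_comul : ∀ n m p q N, n + m = N → p + q = N → mul n m N ≫ comul p q N =
    ∑ x ∈ antidiagonal n, ∑ y ∈ antidiagonal m, if x.1 + y.1 = p then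
      (comul x.1 x.2 n ⊗ₘ comul y.1 y.2 m) ≫ (scalar (lam ^ (x.2 * y.1)) _).hom ≫
        tensorμ _ _ _ _ ≫ (mul x.1 y.1 p ⊗ₘ mul x.2 y.2 q) else 0
  antipode_zero : antipode 0 = 𝟙 _
  antipode_left : ∀ n, ∑ x ∈ antidiagonal (n + 1),
    comul x.1 x.2 (n + 1) ≫ antipode x.1 ▷ T x.2 ≫ mul x.1 x.2 (n + 1) = 0
  antipode_right : ∀ n, ∑ x ∈ antidiagonal (n + 1),
    comul x.1 x.2 (n + 1) ≫ T x.1 ◁ antipode x.2 ≫ mul x.1 x.2 (n + 1) = 0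

namespace GradedHopfComponents

variable {lam : Aut (𝟙_ C)} {T : GradedObject ℕ C} (H : GradedHopfComponents lam T)

theorem mul_zero : H.mul 0 0 0 = (H.unit.inv ⊗ₘ H.unit.inv) ≫ (λ_ _).hom ≫ H.unit.hom := by
  rw [MonoidalCategory.tensorHom_def, Category.assoc, leftUnitor_naturality_assoc,
    Iso.inv_hom_id, Category.comp_id, ← H.one_mul, inv_hom_whiskerRight_assoc]

theorem comul_zero : H.comul 0 0 0 = H.unit.inv ≫ (λ_ _).inv ≫ (H.unit.hom ⊗ₘ H.unit.hom) := by
  rw [MonoidalCategory.tensorHom_def', ← leftUnitor_inv_naturality_assoc,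
    Iso.inv_hom_id_assoc, ← H.counit_comul, Category.assoc, inv_hom_whiskerRight, Category.comp_id]

theorem comul_mul_zero : H.comul 0 0 0 ≫ H.mul 0 0 0 = 𝟙 _ := by
  rw [H.mul_zero, H.comul_zero]
  simp

theorem comul_antipode_mul_zero_left : H.comul 0 0 0 ≫ H.antipode 0 ▷ T 0 ≫ H.mul 0 0 0 = 𝟙 _ := by
  rw [H.antipode_zero, id_whiskerRight, Category.id_comp, H.comul_mul_zero]

theorem comul_antipode_mul_zero_right : H.comul 0 0 0 ≫ T 0 ◁ H.antipode 0 ≫ H.mul 0 0 0 = 𝟙 _ := by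
  rw [H.antipode_zero, whiskerLeft_id, Category.id_comp, H.comul_mul_zero]

variable [MonoidalPreadditive C]

/-- The unit of the graded Hopf algebra. -/
noncomputable def gradedOne : 𝟙_ (GradedObject ℕ C) ⟶ T
  | 0 => unitZero.hom ≫ H.unit.hom
  | _ + 1 => 0

/-- The counit of the graded Hopf algebra. -/
noncomputable def gradedCounit : T ⟶ 𝟙_ (GradedObject ℕ C)
  | 0 => H.unit.inv ≫ unitZero.inv
  | _ + 1 => 0

/-- The product of the graded Hopf algebra. -/
noncomputable def gradedMul : T ⊗ T ⟶ T := fun n => tensorDesc fun i j => H.mul i j n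

/-- The coproduct of the graded Hopf algebra. -/
noncomputable def gradedComul : T ⟶ T ⊗ T := fun n =>
  ∑ x ∈ antidiagonal n, H.comul x.1 x.2 n ≫ tensorι T T x.1 x.2 n

theorem gradedOne_zero : H.gradedOne 0 = unitZero.hom ≫ H.unit.hom := rfl

theorem gradedCounit_zero : H.gradedCounit 0 = H.unit.inv ≫ unitZero.inv := rfl

theorem gradedCounit_succ (n : ℕ) : H.gradedCounit (n + 1) = 0 := rfl

theorem gradedComul_degree (n : ℕ) : H.gradedComul n =
    ∑ x ∈ antidiagonal n, H.comul x.1 x.2 n ≫ tensorι T T x.1 x.2 n := rfl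

theorem tensorι_gradedMul {i j n : ℕ} (h : i + j = n) :
    tensorι T T i j n ≫ H.gradedMul n = H.mul i j n :=
  tensorι_desc _ h

theorem tensorι_gradedMul_assoc {i j n : ℕ} (h : i + j = n) {A : C} (g : T n ⟶ A) :
    tensorι T T i j n ≫ H.gradedMul n ≫ g = H.mul i j n ≫ g := by
  rw [← Category.assoc, H.tensorι_gradedMul h]

theorem gradedOne_mul : H.gradedOne ▷ T ≫ H.gradedMul = (λ_ T).hom := by
  rw [← Iso.inv_comp_eq_id]
  funext n
  change (λ_ T).inv n ≫ (H.gradedOne ▷ T) n ≫ H.gradedMul n = 𝟙 (T n)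
  rw [leftUnitor_inv_degree, Category.assoc, Category.assoc, tensorι_whiskerRight_assoc,
    H.tensorι_gradedMul (zero_add n), gradedOne_zero, comp_whiskerRight, Category.assoc, H.one_mul,
    inv_hom_whiskerRight_assoc, Iso.inv_hom_id]

theorem gradedMul_one : T ◁ H.gradedOne ≫ H.gradedMul = (ρ_ T).hom := by
  rw [← Iso.inv_comp_eq_id]
  funext n
  change (ρ_ T).inv n ≫ (T ◁ H.gradedOne) n ≫ H.gradedMul n = 𝟙 (T n)
  rw [rightUnitor_inv_degree, Category.assoc, Category.assoc, tensorι_whiskerLeft_assoc,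
    H.tensorι_gradedMul (add_zero n), gradedOne_zero, whiskerLeft_comp, Category.assoc, H.mul_one,
    whiskerLeft_inv_hom_assoc, Iso.inv_hom_id]

theorem gradedMul_assoc : H.gradedMul ▷ T ≫ H.gradedMul =
    (α_ T T T).hom ≫ T ◁ H.gradedMul ≫ H.gradedMul := by
  funext N
  apply tensorι_hom_ext₃
  intro i j k h
  change _ ≫ _ ≫ (H.gradedMul ▷ T) N ≫ H.gradedMul N =
    _ ≫ _ ≫ (α_ T T T).hom N ≫ (T ◁ H.gradedMul) N ≫ H.gradedMul N
  have h1 := tensorι_associator_hom T T T (rfl : i + j = i + j) (rfl : j + k = j + k) h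
  rw [reassoc_of% h1, tensorι_whiskerRight_assoc, tensorι_whiskerLeft_assoc,
    H.tensorι_gradedMul (show i + j + k = N from h),
    H.tensorι_gradedMul (show i + (j + k) = N by omega), ← comp_whiskerRight_assoc,
    ← whiskerLeft_comp_assoc, H.tensorι_gradedMul rfl, H.tensorι_gradedMul rfl,
    H.mul_assoc _ _ _ _ h]

theorem gradedCounit_comul : H.gradedComul ≫ H.gradedCounit ▷ T = (λ_ T).inv := by
  funext n
  change H.gradedComul n ≫ (H.gradedCounit ▷ T) n = (λ_ T).inv n
  rw [gradedComul_degree, Preadditive.sum_comp, leftUnitor_inv_degree,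
    sum_eq_single_of_mem (0, n) (by simp)]
  · rw [Category.assoc, tensorι_whiskerRight, gradedCounit_zero, comp_whiskerRight,
      Category.assoc, ← H.counit_comul, Category.assoc]
  · rintro ⟨i, j⟩ hx hne
    rw [HasAntidiagonal.mem_antidiagonal] at hx
    rcases i with - | i
    · exact (hne (Prod.ext rfl ((zero_add j).symm.trans hx))).elim
    · rw [Category.assoc, tensorι_whiskerRight, gradedCounit_succ]
      simp

theorem gradedComul_counit : H.gradedComul ≫ T ◁ H.gradedCounit = (ρ_ T).inv := by
  funext n
  change H.gradedComul n ≫ (T ◁ H.gradedCounit) n = (ρ_ T).inv n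
  rw [gradedComul_degree, Preadditive.sum_comp, rightUnitor_inv_degree,
    sum_eq_single_of_mem (n, 0) (by simp)]
  · rw [Category.assoc, tensorι_whiskerLeft, gradedCounit_zero, whiskerLeft_comp,
      Category.assoc, ← H.comul_counit, Category.assoc]
  · rintro ⟨i, j⟩ hx hne
    rw [HasAntidiagonal.mem_antidiagonal] at hx
    rcases j with - | j
    · exact (hne (Prod.ext hx rfl)).elim
    · rw [Category.assoc, tensorι_whiskerLeft, gradedCounit_succ]
      simp

theorem gradedComul_assoc : H.gradedComul ≫ T ◁ H.gradedComul =
    H.gradedComul ≫ H.gradedComul ▷ T ≫ (α_ T T T).hom := by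
  funext N
  change H.gradedComul N ≫ (T ◁ H.gradedComul) N =
    H.gradedComul N ≫ (H.gradedComul ▷ T) N ≫ (α_ T T T).hom N
  rw [gradedComul_degree, Preadditive.sum_comp, Preadditive.sum_comp]
  have h1 : ∀ x ∈ antidiagonal N, (H.comul x.1 x.2 N ≫ tensorι T T x.1 x.2 N) ≫
      (T ◁ H.gradedComul) N = ∑ y ∈ antidiagonal x.2, H.comul x.1 (y.1 + y.2) N ≫
        T x.1 ◁ H.comul y.1 y.2 (y.1 + y.2) ≫ T x.1 ◁ tensorι T T y.1 y.2 (y.1 + y.2) ≫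
          tensorι T (T ⊗ T) x.1 (y.1 + y.2) N := by
    rintro ⟨i, m⟩ hx
    rw [Category.assoc, tensorι_whiskerLeft, gradedComul_degree, whiskerLeft_sum,
      Preadditive.sum_comp, Preadditive.comp_sum]
    refine sum_congr rfl fun y hy => ?_
    rw [HasAntidiagonal.mem_antidiagonal] at hy
    dsimp only at hy ⊢
    rw [← hy, whiskerLeft_comp, Category.assoc]
  have h2 : ∀ x ∈ antidiagonal N, (H.comul x.1 x.2 N ≫ tensorι T T x.1 x.2 N) ≫
      (H.gradedComul ▷ T) N ≫ (α_ T T T).hom N = ∑ y ∈ antidiagonal x.1,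
        H.comul y.1 (y.2 + x.2) N ≫ T y.1 ◁ H.comul y.2 x.2 (y.2 + x.2) ≫
          T y.1 ◁ tensorι T T y.2 x.2 (y.2 + x.2) ≫ tensorι T (T ⊗ T) y.1 (y.2 + x.2) N := by
    rintro ⟨n, k⟩ hx
    rw [HasAntidiagonal.mem_antidiagonal] at hx
    rw [Category.assoc, tensorι_whiskerRight_assoc, gradedComul_degree, sum_whiskerRight,
      Preadditive.sum_comp, Preadditive.comp_sum]
    refine sum_congr rfl fun y hy => ?_
    rw [HasAntidiagonal.mem_antidiagonal] at hy
    dsimp only at hx hy ⊢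
    subst hy
    rw [comp_whiskerRight, Category.assoc, tensorι_associator_hom T T T rfl rfl hx]
    have := H.comul_assoc y.1 y.2 k N hx
    rw [reassoc_of% this]
  rw [sum_congr rfl h1, sum_congr rfl h2]
  exact sum_antidiagonal_assoc (fun i j k => H.comul i (j + k) N ≫ T i ◁ H.comul j k (j + k) ≫
    T i ◁ tensorι T T j k (j + k) ≫ tensorι T (T ⊗ T) i (j + k) N) N

/-- The unit object is zero in positive degrees. -/
theorem unit_hom_ext {n : ℕ} {A : C} (f g : (𝟙_ (GradedObject ℕ C)) (n + 1) ⟶ A) : f = g :=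
  (GradedObject.Monoidal.isInitialTensorUnitApply (C := C) (n + 1) n.succ_ne_zero).hom_ext f g

theorem gradedOne_comul : H.gradedOne ≫ H.gradedComul =
    (λ_ (𝟙_ (GradedObject ℕ C))).inv ≫ (H.gradedOne ⊗ₘ H.gradedOne) := by
  funext n
  rcases n with - | n
  · change H.gradedOne 0 ≫ H.gradedComul 0 =
      (λ_ (𝟙_ (GradedObject ℕ C))).inv 0 ≫ (H.gradedOne ⊗ₘ H.gradedOne) 0
    rw [leftUnitor_inv_degree, Category.assoc, Category.assoc, tensorι_tensorHom, gradedOne_zero,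
      gradedComul_degree, Nat.antidiagonal_zero, sum_singleton, H.comul_zero]
    simp only [Category.assoc, Iso.hom_inv_id_assoc, ← tensorHom_comp_tensorHom]
    rw [MonoidalCategory.tensorHom_def unitZero.hom, Category.assoc, inv_hom_whiskerRight_assoc,
      leftUnitor_inv_naturality_assoc]
  · exact unit_hom_ext _ _

theorem gradedMul_counit : H.gradedMul ≫ H.gradedCounit =
    (H.gradedCounit ⊗ₘ H.gradedCounit) ≫ (λ_ (𝟙_ (GradedObject ℕ C))).hom := by
  funext n
  apply tensorι_hom_ext
  intro i j h
  change _ ≫ H.gradedMul n ≫ H.gradedCounit n =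
    _ ≫ (H.gradedCounit ⊗ₘ H.gradedCounit) n ≫ (λ_ (𝟙_ (GradedObject ℕ C))).hom n
  rw [H.tensorι_gradedMul_assoc h, ← Category.assoc (tensorι _ _ _ _ _), tensorι_tensorHom]
  rcases i with - | i
  · rcases j with - | j
    · obtain rfl : n = 0 := by omega
      have h1 : (λ_ (𝟙_ (GradedObject ℕ C))).inv 0 ≫ (λ_ (𝟙_ (GradedObject ℕ C))).hom 0 = 𝟙 _ :=
        congrFun (λ_ (𝟙_ (GradedObject ℕ C))).inv_hom_id 0
      rw [leftUnitor_inv_degree] at h1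
      have h2 : tensorι (𝟙_ (GradedObject ℕ C)) (𝟙_ (GradedObject ℕ C)) 0 0 0 ≫
          (λ_ (𝟙_ (GradedObject ℕ C))).hom 0 =
          (unitZero (C := C)).hom ▷ _ ≫ (λ_ _).hom := by
        rw [← cancel_epi ((λ_ _).inv ≫ (unitZero (C := C)).inv ▷ _)]
        simpa using h1
      rw [Category.assoc, h2, gradedCounit_zero, H.mul_zero, ← tensorHom_comp_tensorHom]
      simp only [Category.assoc, Iso.hom_inv_id_assoc]
      rw [MonoidalCategory.tensorHom_def' unitZero.inv, Category.assoc, inv_hom_whiskerRight_assoc,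
        leftUnitor_naturality]
    · obtain rfl : n = j + 1 := by omega
      rw [gradedCounit_succ]
      simp
  · obtain ⟨n, rfl⟩ : ∃ k, n = k + 1 := ⟨i + j, by omega⟩
    rw [gradedCounit_succ, gradedCounit_succ]
    simp

theorem gradedOne_counit : H.gradedOne ≫ H.gradedCounit = 𝟙 _ := by
  funext n
  rcases n with - | n
  · change (unitZero.hom ≫ H.unit.hom) ≫ H.unit.inv ≫ unitZero.inv = 𝟙 _
    simp
  · exact unit_hom_ext _ _

theorem gradedMul_comul : H.gradedMul ≫ H.gradedComul = (H.gradedComul ⊗ₘ H.gradedComul) ≫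
    gradedTensorμ lam T T T T ≫ (H.gradedMul ⊗ₘ H.gradedMul) := by
  funext N
  apply tensorι_hom_ext
  intro n m h
  change _ ≫ H.gradedMul N ≫ H.gradedComul N = _ ≫ (H.gradedComul ⊗ₘ H.gradedComul) N ≫
    gradedTensorμ lam T T T T N ≫ (H.gradedMul ⊗ₘ H.gradedMul) N
  rw [H.tensorι_gradedMul_assoc h, ← Category.assoc (tensorι _ _ _ _ _), tensorι_tensorHom,
    gradedComul_degree, gradedComul_degree, gradedComul_degree, sum_tensor, Preadditive.comp_sum,
    Category.assoc, Preadditive.sum_comp]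
  have h1 : ∀ z ∈ antidiagonal N, H.mul n m N ≫ H.comul z.1 z.2 N ≫ tensorι T T z.1 z.2 N =
      ∑ x ∈ antidiagonal n, ∑ y ∈ antidiagonal m, if x.1 + y.1 = z.1 then
        (H.comul x.1 x.2 n ⊗ₘ H.comul y.1 y.2 m) ≫ (scalar (lam ^ (x.2 * y.1)) _).hom ≫
          tensorμ _ _ _ _ ≫ (H.mul x.1 y.1 z.1 ⊗ₘ H.mul x.2 y.2 z.2) ≫ tensorι T T z.1 z.2 N
        else 0 := by
    intro z hz
    rw [HasAntidiagonal.mem_antidiagonal] at hz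
    rw [← Category.assoc, H.mul_comul n m z.1 z.2 N h hz]
    simp only [Preadditive.sum_comp]
    refine sum_congr rfl fun x _ => sum_congr rfl fun y _ => ?_
    split_ifs
    · simp only [Category.assoc]
    · rw [zero_comp]
  rw [sum_congr rfl h1, sum_comm]
  refine sum_congr rfl fun x hx => ?_
  rw [tensor_sum, Preadditive.sum_comp, sum_comm]
  refine sum_congr rfl fun y hy => ?_
  rw [HasAntidiagonal.mem_antidiagonal] at hx hy
  rw [sum_eq_single_of_mem (x.1 + y.1, x.2 + y.2)
    (by rw [HasAntidiagonal.mem_antidiagonal]; dsimp only; omega), if_pos rfl,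
    ← tensorHom_comp_tensorHom, Category.assoc]
  · have h2 := tensorι_gradedTensorμ lam T T T T hx hy rfl rfl h
    rw [reassoc_of% h2, tensorι_tensorHom, tensorHom_comp_tensorHom_assoc,
      H.tensorι_gradedMul rfl, H.tensorι_gradedMul rfl]
  · rintro ⟨p, q⟩ hz hne
    rw [HasAntidiagonal.mem_antidiagonal] at hz
    refine if_neg fun hp => hne ?_
    dsimp only at hz hp
    exact Prod.ext hp.symm (by dsimp only; omega)

theorem gradedCounit_one_zero : H.gradedCounit 0 ≫ H.gradedOne 0 = 𝟙 _ := by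
  rw [gradedCounit_zero, gradedOne_zero]
  simp

/-- The antipode of the graded Hopf algebra. -/
def gradedAntipode : T ⟶ T := H.antipode

theorem gradedAntipode_left : H.gradedComul ≫ H.gradedAntipode ▷ T ≫ H.gradedMul =
    H.gradedCounit ≫ H.gradedOne := by
  funext n
  change H.gradedComul n ≫ (H.gradedAntipode ▷ T) n ≫ H.gradedMul n =
    H.gradedCounit n ≫ H.gradedOne n
  have h : H.gradedComul n ≫ (H.gradedAntipode ▷ T) n ≫ H.gradedMul n =
      ∑ x ∈ antidiagonal n, H.comul x.1 x.2 n ≫ H.antipode x.1 ▷ T x.2 ≫ H.mul x.1 x.2 n := by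
    rw [gradedComul_degree, Preadditive.sum_comp]
    refine sum_congr rfl fun x hx => ?_
    rw [HasAntidiagonal.mem_antidiagonal] at hx
    rw [Category.assoc, tensorι_whiskerRight_assoc, H.tensorι_gradedMul hx, gradedAntipode]
  rw [h]
  rcases n with - | n
  · rw [H.gradedCounit_one_zero, Nat.antidiagonal_zero, sum_singleton,
      H.comul_antipode_mul_zero_left]
  · rw [H.antipode_left, gradedCounit_succ, zero_comp]

theorem gradedAntipode_right : H.gradedComul ≫ T ◁ H.gradedAntipode ≫ H.gradedMul =
    H.gradedCounit ≫ H.gradedOne := by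
  funext n
  change H.gradedComul n ≫ (T ◁ H.gradedAntipode) n ≫ H.gradedMul n =
    H.gradedCounit n ≫ H.gradedOne n
  have h : H.gradedComul n ≫ (T ◁ H.gradedAntipode) n ≫ H.gradedMul n =
      ∑ x ∈ antidiagonal n, H.comul x.1 x.2 n ≫ T x.1 ◁ H.antipode x.2 ≫ H.mul x.1 x.2 n := by
    rw [gradedComul_degree, Preadditive.sum_comp]
    refine sum_congr rfl fun x hx => ?_
    rw [HasAntidiagonal.mem_antidiagonal] at hx
    rw [Category.assoc, tensorι_whiskerLeft_assoc, H.tensorι_gradedMul hx, gradedAntipode]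
  rw [h]
  rcases n with - | n
  · rw [H.gradedCounit_one_zero, Nat.antidiagonal_zero, sum_singleton,
      H.comul_antipode_mul_zero_right]
  · rw [H.antipode_right, gradedCounit_succ, zero_comp]

/-- The Hopf algebra in the category of graded objects with the given components. -/
noncomputable abbrev toGradedHopf : GradedHopf lam T :=
  letI := gradedBraided (C := C) lam
  { one := H.gradedOne
    mul := H.gradedMul
    one_mul := H.gradedOne_mul
    mul_one := H.gradedMul_one
    mul_assoc := H.gradedMul_assoc
    counit := H.gradedCounit
    comul := H.gradedComul
    counit_comul := H.gradedCounit_comul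
    comul_counit := H.gradedComul_counit
    comul_assoc := H.gradedComul_assoc
    one_comul := H.gradedOne_comul
    mul_comul := H.gradedMul_comul
    mul_counit := H.gradedMul_counit
    one_counit := H.gradedOne_counit
    antipode := H.gradedAntipode
    antipode_left := H.gradedAntipode_left
    antipode_right := H.gradedAntipode_right }

theorem inclTensor_gradedMul (n m : ℕ) :
    inclTensor T T n m ≫ H.gradedMul (n + m) = H.mul n m (n + m) := by
  rw [← H.tensorι_gradedMul rfl, tensorι_of_eq T T rfl, inclTensor]

theorem gradedComul_projTensor (n m : ℕ) :
    H.gradedComul (n + m) ≫ projTensor T T n m = H.comul n m (n + m) := by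
  have h : ∀ x ∈ antidiagonal (n + m), tensorι T T x.1 x.2 (n + m) ≫ projTensor T T n m =
      if h : x.1 = n ∧ x.2 = m then eqToHom (by rw [h.1, h.2]) else 0 := by
    intro x hx
    rw [HasAntidiagonal.mem_antidiagonal] at hx
    rw [tensorι_of_eq T T hx]
    exact GradedObject.Monoidal.ι_tensorObjDesc _ _ _ _
  rw [gradedComul_degree, Preadditive.sum_comp, sum_eq_single_of_mem (n, m) (by simp)]
  · rw [Category.assoc, h (n, m) (by simp), dif_pos ⟨rfl, rfl⟩, eqToHom_refl, Category.comp_id]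
  · rintro x hx hne
    rw [Category.assoc, h x hx, dif_neg (fun hh => hne (Prod.ext hh.1 hh.2)), comp_zero]

end GradedHopfComponents

end GradedHopfComponents

/-! ### Hopf algebra structures on the tensor algebra -/

section TensorHopfData

open Finset

variable {C : Type u} [Category.{v} C] [Abelian C] [MonoidalCategory C] [MonoidalPreadditive C]

theorem tensorHom_comp_concatTo (X : C) {n m N : ℕ} (h : n + m = N) (f : End (tensorPow X n))
    (g : End (tensorPow X m)) : (f ⊗ₘ g) ≫ (concatTo X n m N h).hom =
      (concatTo X n m N h).hom ≫ (extendRight X n m N h f * extendLeft X n m N h g : End _) := by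
  rw [End.mul_def, MonoidalCategory.tensorHom_def', Category.assoc, ← concatTo_comp_extendRight,
    ← Category.assoc, ← concatTo_comp_extendLeft, Category.assoc]

variable [BraidedCategory C]

/-- The composition occurring in the compatibility of product and coproduct, in terms of
endomorphisms of a single tensor power. -/
theorem tensorHom_comp_tensorμ_comp_tensorHom (lam : Aut (𝟙_ C)) (X : C) {i j k l n m p q N : ℕ}
    (hn : i + j = n) (hm : k + l = m) (hp : i + k = p) (hq : j + l = q) (hN : n + m = N)
    (hN' : p + q = N) (f : End (tensorPow X n)) (g : End (tensorPow X m))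
    (f' : End (tensorPow X p)) (g' : End (tensorPow X q)) :
    ((f ≫ (concatTo X i j n hn).inv) ⊗ₘ (g ≫ (concatTo X k l m hm).inv)) ≫
        (scalar (lam ^ (j * k)) _).hom ≫
          tensorμ (tensorPow X i) (tensorPow X j) (tensorPow X k) (tensorPow X l) ≫
            (((concatTo X i k p hp).hom ≫ f') ⊗ₘ ((concatTo X j l q hq).hom ≫ g')) =
      (concatTo X n m N hN).hom ≫ (extendRight X p q N hN' f' * extendLeft X p q N hN' g' *
        blockBraid (twistedSeq lam X N) i j k *
          (extendRight X n m N hN f * extendLeft X n m N hN g) : End _) ≫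
            (concatTo X p q N hN').inv := by
  have h := tensorμ_comp_concatTo lam X i j k l n m p q N hn hm hp hq hN hN'
  have h₁ := tensorHom_comp_concatTo X hN f g
  have h₂ := tensorHom_comp_concatTo X hN' f' g'
  generalize extendRight X n m N hN f * extendLeft X n m N hN g = r at h₁ ⊢
  generalize extendRight X p q N hN' f' * extendLeft X p q N hN' g' = r' at h₂ ⊢
  rw [← cancel_mono (concatTo X p q N hN').hom, End.mul_def, End.mul_def,
    ← tensorHom_comp_tensorHom, ← tensorHom_comp_tensorHom]
  simp only [Category.assoc]
  rw [h₂, reassoc_of% h, ← reassoc_of% h₁]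
  simp

/-- Families of endomorphisms of the tensor powers of `X` from which product and coproduct of a
graded Hopf algebra structure on the tensor algebra are obtained by composition with the canonical
isomorphisms `X^i ⊗ X^j ≅ X^(i + j)`. The endomorphisms `mul N a i j` and `comul N a i j` of `X^N`
act on the `i + j` factors starting at `a`. -/
structure TensorHopfData (lam : Aut (𝟙_ C)) (X : C) where
  /-- The endomorphisms that define the product. -/
  mul : ∀ N : ℕ, ℕ → ℕ → ℕ → End (tensorPow X N)
  /-- The endomorphisms that define the coproduct. -/
  comul : ∀ N : ℕ, ℕ → ℕ → ℕ → End (tensorPow X N)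
  extendRight_mul : ∀ {n m N i j : ℕ} (h : n + m = N), i + j = n →
    extendRight X n m N h (mul n 0 i j) = mul N 0 i j
  extendLeft_mul : ∀ {n m N i j : ℕ} (h : n + m = N), i + j = m →
    extendLeft X n m N h (mul m 0 i j) = mul N n i j
  extendRight_comul : ∀ {n m N i j : ℕ} (h : n + m = N), i + j = n →
    extendRight X n m N h (comul n 0 i j) = comul N 0 i j
  extendLeft_comul : ∀ {n m N i j : ℕ} (h : n + m = N), i + j = m →
    extendLeft X n m N h (comul m 0 i j) = comul N n i j
  mul_zero_left : ∀ n, mul n 0 0 n = 1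
  mul_zero_right : ∀ n, mul n 0 n 0 = 1
  comul_zero_left : ∀ n, comul n 0 0 n = 1
  comul_zero_right : ∀ n, comul n 0 n 0 = 1
  mul_assoc : ∀ N i j k, mul N 0 (i + j) k * mul N 0 i j = mul N 0 i (j + k) * mul N i j k
  comul_assoc : ∀ N i j k,
    comul N 0 i j * comul N 0 (i + j) k = comul N i j k * comul N 0 i (j + k)
  comul_mul : ∀ N n m p q, n + m = N → p + q = N → comul N 0 p q * mul N 0 n m =
    ∑ x ∈ antidiagonal n, ∑ y ∈ antidiagonal m, if x.1 + y.1 = p then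
      mul N 0 x.1 y.1 * mul N p x.2 y.2 * blockBraid (twistedSeq lam X N) x.1 x.2 y.1 *
        (comul N 0 x.1 x.2 * comul N n y.1 y.2) else 0
  mul_halfTwist_comul_left : ∀ n, ∑ x ∈ antidiagonal (n + 1), mul (n + 1) 0 x.1 x.2 *
    ((-1) ^ x.1 * halfTwist (twistedSeq lam X (n + 1)) 0 x.1) * comul (n + 1) 0 x.1 x.2 = 0
  mul_halfTwist_comul_right : ∀ n, ∑ x ∈ antidiagonal (n + 1), mul (n + 1) 0 x.1 x.2 *
    ((-1) ^ x.2 * halfTwist (twistedSeq lam X (n + 1)) x.1 x.2) * comul (n + 1) 0 x.1 x.2 = 0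

namespace TensorHopfData

variable {lam : Aut (𝟙_ C)} {X : C} (H : TensorHopfData lam X)

/-- The components of the product. -/
def mulHom (i j n : ℕ) : tensorPow X i ⊗ tensorPow X j ⟶ tensorPow X n :=
  if h : i + j = n then (concatTo X i j n h).hom ≫ H.mul n 0 i j else 0

/-- The components of the coproduct. -/
def comulHom (i j n : ℕ) : tensorPow X n ⟶ tensorPow X i ⊗ tensorPow X j :=
  if h : i + j = n then H.comul n 0 i j ≫ (concatTo X i j n h).inv else 0

theorem mulHom_of_eq {i j n : ℕ} (h : i + j = n) :
    H.mulHom i j n = (concatTo X i j n h).hom ≫ H.mul n 0 i j := dif_pos h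

theorem comulHom_of_eq {i j n : ℕ} (h : i + j = n) :
    H.comulHom i j n = H.comul n 0 i j ≫ (concatTo X i j n h).inv := dif_pos h

theorem mulHom_assoc (i j k N : ℕ) (h : i + j + k = N) :
    H.mulHom i j (i + j) ▷ tensorPow X k ≫ H.mulHom (i + j) k N =
      (α_ _ _ _).hom ≫ tensorPow X i ◁ H.mulHom j k (j + k) ≫ H.mulHom i (j + k) N := by
  have h' : i + (j + k) = N := by omega
  rw [H.mulHom_of_eq rfl, H.mulHom_of_eq rfl, H.mulHom_of_eq h, H.mulHom_of_eq h',
    comp_whiskerRight, whiskerLeft_comp, Category.assoc, Category.assoc,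
    ← reassoc_of% (concatTo_comp_extendRight X _ k N h (H.mul (i + j) 0 i j)),
    ← reassoc_of% (concatTo_comp_extendLeft X i _ N h' (H.mul (j + k) 0 j k)),
    H.extendRight_mul h rfl, H.extendLeft_mul h' rfl,
    reassoc_of% (concatTo_assoc X i j k _ _ N rfl rfl h h')]
  have := H.mul_assoc N i j k
  rw [End.mul_def, End.mul_def] at this
  rw [this]

theorem comulHom_assoc (i j k N : ℕ) (h : i + j + k = N) :
    H.comulHom i (j + k) N ≫ tensorPow X i ◁ H.comulHom j k (j + k) =
      H.comulHom (i + j) k N ≫ H.comulHom i j (i + j) ▷ tensorPow X k ≫ (α_ _ _ _).hom := by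
  have h' : i + (j + k) = N := by omega
  have h1 : (concatTo X (i + j) k N h).inv ≫ H.comul (i + j) 0 i j ▷ tensorPow X k =
      H.comul N 0 i j ≫ (concatTo X (i + j) k N h).inv := by
    rw [← H.extendRight_comul h rfl, extendRight_apply]
    simp
  have h2 : (concatTo X i (j + k) N h').inv ≫ tensorPow X i ◁ H.comul (j + k) 0 j k =
      H.comul N i j k ≫ (concatTo X i (j + k) N h').inv := by
    rw [← H.extendLeft_comul h' rfl, extendLeft_apply]
    simp
  have h3 : (concatTo X (i + j) k N h).inv ≫ (concatTo X i j _ rfl).inv ▷ tensorPow X k ≫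
      (α_ _ _ _).hom = (concatTo X i (j + k) N h').inv ≫
        tensorPow X i ◁ (concatTo X j k _ rfl).inv := by
    have := concatTo_assoc X i j k _ _ N rfl rfl h h'
    rw [Iso.inv_comp_eq, ← cancel_epi ((concatTo X i j _ rfl).hom ▷ tensorPow X k),
      reassoc_of% this, hom_inv_whiskerRight_assoc, Iso.hom_inv_id_assoc,
      whiskerLeft_hom_inv, Category.comp_id]
  rw [H.comulHom_of_eq rfl, H.comulHom_of_eq rfl, H.comulHom_of_eq h, H.comulHom_of_eq h',
    comp_whiskerRight, whiskerLeft_comp, Category.assoc, Category.assoc, Category.assoc,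
    reassoc_of% h1, reassoc_of% h2, h3]
  have := H.comul_assoc N i j k
  rw [End.mul_def, End.mul_def] at this
  rw [reassoc_of% this]

theorem mulHom_comulHom (n m p q N : ℕ) (hN : n + m = N) (hN' : p + q = N) :
    H.mulHom n m N ≫ H.comulHom p q N =
      ∑ x ∈ antidiagonal n, ∑ y ∈ antidiagonal m, if x.1 + y.1 = p then
        (H.comulHom x.1 x.2 n ⊗ₘ H.comulHom y.1 y.2 m) ≫ (scalar (lam ^ (x.2 * y.1)) _).hom ≫
          tensorμ _ _ _ _ ≫ (H.mulHom x.1 y.1 p ⊗ₘ H.mulHom x.2 y.2 q) else 0 := by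
  have h := H.comul_mul N n m p q hN hN'
  rw [End.mul_def] at h
  rw [H.mulHom_of_eq hN, H.comulHom_of_eq hN', Category.assoc, reassoc_of% h, Preadditive.sum_comp,
    Preadditive.comp_sum]
  refine sum_congr rfl fun x hx => ?_
  rw [Preadditive.sum_comp, Preadditive.comp_sum]
  refine sum_congr rfl fun y hy => ?_
  rw [HasAntidiagonal.mem_antidiagonal] at hx hy
  by_cases hp : x.1 + y.1 = p
  · have hq : x.2 + y.2 = q := by omega
    rw [if_pos hp, if_pos hp, H.comulHom_of_eq hx, H.comulHom_of_eq hy, H.mulHom_of_eq hp,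
      H.mulHom_of_eq hq, tensorHom_comp_tensorμ_comp_tensorHom lam X hx hy hp hq hN hN',
      H.extendRight_mul hN' hp, H.extendLeft_mul hN' hq, H.extendRight_comul hN hx,
      H.extendLeft_comul hN hy]
  · rw [if_neg hp, if_neg hp, zero_comp, comp_zero]

theorem comulHom_whiskerRight_mulHom {i j n : ℕ} (h : i + j = n) (f : End (tensorPow X i)) :
    H.comulHom i j n ≫ f ▷ tensorPow X j ≫ H.mulHom i j n =
      (H.mul n 0 i j * extendRight X i j n h f * H.comul n 0 i j : End _) := by
  rw [H.comulHom_of_eq h, H.mulHom_of_eq h, End.mul_def, End.mul_def, extendRight_apply]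
  simp only [Category.assoc]

theorem comulHom_whiskerLeft_mulHom {i j n : ℕ} (h : i + j = n) (f : End (tensorPow X j)) :
    H.comulHom i j n ≫ tensorPow X i ◁ f ≫ H.mulHom i j n =
      (H.mul n 0 i j * extendLeft X i j n h f * H.comul n 0 i j : End _) := by
  rw [H.comulHom_of_eq h, H.mulHom_of_eq h, End.mul_def, End.mul_def, extendLeft_apply]
  simp only [Category.assoc]

/-- The components of the graded Hopf algebra. -/
noncomputable def toGradedHopfComponents : GradedHopfComponents lam (tensorAlgebra X) where
  unit := Iso.refl (𝟙_ C)
  mul := H.mulHom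
  comul := H.comulHom
  antipode := tensorAntipode lam X
  one_mul n := by
    rw [H.mulHom_of_eq (zero_add n), H.mul_zero_left, concatTo_zero_left]
    change (𝟙 _) ▷ _ ≫ _ ≫ 𝟙 _ = _
    rw [id_whiskerRight, Category.comp_id, Category.id_comp]
  mul_one n := by
    rw [H.mulHom_of_eq (add_zero n), H.mul_zero_right, concatTo_zero]
    change _ ◁ (𝟙 _) ≫ _ ≫ 𝟙 _ = _
    rw [whiskerLeft_id, Category.comp_id, Category.id_comp]
  mul_assoc := H.mulHom_assoc
  counit_comul n := by
    have h : (concatTo X 0 n n (zero_add n)).inv = (λ_ (tensorPow X n)).inv :=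
      (Iso.inv_eq_inv _ _).2 (concatTo_zero_left X n)
    rw [H.comulHom_of_eq (zero_add n), H.comul_zero_left, h]
    change (𝟙 _ ≫ _) ≫ (𝟙 _) ▷ _ = _
    rw [id_whiskerRight, Category.comp_id, Category.id_comp]
  comul_counit n := by
    rw [H.comulHom_of_eq (add_zero n), H.comul_zero_right, concatTo_zero]
    change (𝟙 _ ≫ _) ≫ _ ◁ (𝟙 _) = _
    rw [whiskerLeft_id, Category.comp_id, Category.id_comp]
  comul_assoc := H.comulHom_assoc
  mul_comul := H.mulHom_comulHom
  antipode_zero := by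
    rw [tensorAntipode_eq_halfTwist, pow_zero, one_mul]
    rfl
  antipode_left n := by
    refine (sum_congr rfl fun x hx => ?_).trans (H.mul_halfTwist_comul_left n)
    rw [HasAntidiagonal.mem_antidiagonal] at hx
    rw [H.comulHom_whiskerRight_mulHom hx, tensorAntipode_eq_halfTwist, map_mul, map_pow, map_neg,
      map_one, extendRight_halfTwist]
  antipode_right n := by
    refine (sum_congr rfl fun x hx => ?_).trans (H.mul_halfTwist_comul_right n)
    rw [HasAntidiagonal.mem_antidiagonal] at hx
    rw [H.comulHom_whiskerLeft_mulHom hx, tensorAntipode_eq_halfTwist, map_mul, map_pow, map_neg,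
      map_one, extendLeft_halfTwist]

/-- The graded Hopf algebra obtained from the data, with its structure morphisms in components. -/
theorem exists_gradedHopf : ∃ K : GradedHopf lam (tensorAlgebra X),
    (∀ n m, inclTensor _ _ n m ≫ K.mul (n + m) =
      (concat X n m).hom ≫ H.mul (n + m) 0 n m) ∧
    (K.one 0 = unitZero.hom ∧ ∀ j, j ≠ 0 → K.one j = 0) ∧
    (∀ n m, K.comul (n + m) ≫ projTensor _ _ n m =
      H.comul (n + m) 0 n m ≫ (concat X n m).inv) ∧
    (K.counit 0 = unitZero.inv ∧ ∀ j, j ≠ 0 → K.counit j = 0) ∧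
    (∀ n, K.antipode n = tensorAntipode lam X n) := by
  refine ⟨H.toGradedHopfComponents.toGradedHopf, fun n m => ?_, ⟨?_, ?_⟩, fun n m => ?_,
    ⟨?_, ?_⟩, fun n => rfl⟩
  · rw [← concatTo_rfl, ← H.mulHom_of_eq rfl]
    exact H.toGradedHopfComponents.inclTensor_gradedMul n m
  · exact Category.comp_id _
  · rintro (- | j) hj
    · exact absurd rfl hj
    · rfl
  · rw [← concatTo_rfl, ← H.comulHom_of_eq rfl]
    exact H.toGradedHopfComponents.gradedComul_projTensor n m
  · exact Category.id_comp _
  · rintro (- | j) hj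
    · exact absurd rfl hj
    · rfl

/-- The data with trivial product and the shuffle elements as coproduct. -/
def ofShuf (lam : Aut (𝟙_ C)) (X : C) : TensorHopfData lam X where
  mul _ _ _ _ := 1
  comul N := shuf (twistedSeq lam X N)
  extendRight_mul _ _ := map_one _
  extendLeft_mul _ _ := map_one _
  extendRight_comul h hij := extendRight_shuf lam X h hij
  extendLeft_comul h hij := extendLeft_shuf lam X h hij
  mul_zero_left _ := rfl
  mul_zero_right _ := rfl
  comul_zero_left _ := shuf_zero_left _ _ _
  comul_zero_right _ := shuf_zero_right _ _ _
  mul_assoc _ _ _ _ := rfl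
  comul_assoc N i j k := by
    have := (isBraidSeq_twistedSeq lam X N).shuf_coassoc 0 i j k
    rwa [zero_add] at this
  comul_mul N n m p q hN hN' := by
    rw [mul_one, (isBraidSeq_twistedSeq lam X N).shuf_compat n m p q (hN'.trans hN.symm)]
    simp only [one_mul, _root_.mul_assoc]
  mul_halfTwist_comul_left n := by
    simpa only [one_mul, _root_.mul_assoc] using
      (isBraidSeq_twistedSeq lam X (n + 1)).sum_halfTwist_mul_shuf' n
  mul_halfTwist_comul_right n := by
    simpa only [one_mul, _root_.mul_assoc] using
      (isBraidSeq_twistedSeq lam X (n + 1)).sum_halfTwist_mul_shuf n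

/-- The data with the dual shuffle elements as product and trivial coproduct. -/
def ofDualShuf (lam : Aut (𝟙_ C)) (X : C) : TensorHopfData lam X where
  mul N := dualShuf (twistedSeq lam X N)
  comul _ _ _ _ := 1
  extendRight_mul h hij := extendRight_dualShuf lam X h hij
  extendLeft_mul h hij := extendLeft_dualShuf lam X h hij
  extendRight_comul _ _ := map_one _
  extendLeft_comul _ _ := map_one _
  mul_zero_left _ := dualShuf_zero_left _ _ _
  mul_zero_right _ := dualShuf_zero_right _ _ _
  comul_zero_left _ := rfl
  comul_zero_right _ := rfl
  mul_assoc N i j k := by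
    have := (isBraidSeq_twistedSeq lam X N).dualShuf_assoc 0 i j k
    rwa [zero_add] at this
  comul_assoc _ _ _ _ := rfl
  comul_mul N n m p q hN hN' := by
    rw [one_mul, (isBraidSeq_twistedSeq lam X N).dualShuf_compat n m p q (hN'.trans hN.symm)]
    simp only [mul_one]
  mul_halfTwist_comul_left n := by
    have h := (isBraidSeq_twistedSeq lam X (n + 1)).sum_dualShuf_mul_halfTwist' n
    rw [← h]
    refine sum_congr rfl fun x _ => ?_
    rw [mul_one, ← _root_.mul_assoc, ← _root_.mul_assoc, ((Commute.neg_one_left _).pow_left _).eq]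
  mul_halfTwist_comul_right n := by
    have h := (isBraidSeq_twistedSeq lam X (n + 1)).sum_dualShuf_mul_halfTwist n
    rw [← h]
    refine sum_congr rfl fun x _ => ?_
    rw [mul_one, ← _root_.mul_assoc, ← _root_.mul_assoc, ((Commute.neg_one_left _).pow_left _).eq]

end TensorHopfData

end TensorHopfData

end BraidedTensorHopf

theorem mainTheorem4 {C : Type u} [Category.{v} C] [Abelian C] [MonoidalCategory C]
    [MonoidalPreadditive C] [BraidedCategory C] (hC : IsTensorFactor C)
    (lam : Aut (𝟙_ C)) (X : C) :
    (∃ H : GradedHopf lam (tensorAlgebra X),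
      (∀ n m, inclTensor _ _ n m ≫ H.mul (n + m) = (concat X n m).hom) ∧
      (H.one 0 = unitZero.hom ∧ ∀ j, j ≠ 0 → H.one j = 0) ∧
      (∀ n m, H.comul (n + m) ≫ projTensor _ _ n m =
        braidedBinomial lam X n m ≫ (concat X n m).inv) ∧
      (H.counit 0 = unitZero.inv ∧ ∀ j, j ≠ 0 → H.counit j = 0) ∧
      (∀ n, H.antipode n = tensorAntipode lam X n)) ∧
    (∃ H : GradedHopf lam (tensorAlgebra X),
      (∀ n m, inclTensor _ _ n m ≫ H.mul (n + m) =
        (concat X n m).hom ≫ dualBraidedBinomial lam X n m) ∧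
      (H.one 0 = unitZero.hom ∧ ∀ j, j ≠ 0 → H.one j = 0) ∧
      (∀ n m, H.comul (n + m) ≫ projTensor _ _ n m = (concat X n m).inv) ∧
      (H.counit 0 = unitZero.inv ∧ ∀ j, j ≠ 0 → H.counit j = 0) ∧
      (∀ n, H.antipode n = tensorAntipode lam X n)) := by
  constructor
  · obtain ⟨H, h1, h2, h3, h4⟩ := (TensorHopfData.ofShuf lam X).exists_gradedHopf
    refine ⟨H, fun n m => (h1 n m).trans (Category.comp_id _), h2, fun n m => ?_, h4⟩
    rw [braidedBinomial_eq_shuf]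
    exact h3 n m
  · obtain ⟨H, h1, h2, h3, h4⟩ := (TensorHopfData.ofDualShuf lam X).exists_gradedHopf
    refine ⟨H, fun n m => ?_, h2, fun n m => (h3 n m).trans (Category.id_comp _), h4⟩
    rw [dualBraidedBinomial_eq_dualShuf]
    exact h1 n m
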